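/- Let $s\in[-\tfrac12,1]$ be a fixed non-zero constant. For $n\in\mathbb{S}^2\subset\mathbb{R}^3$ put $P(n)=s\left(n\otimes n-\tfrac13\,\mathrm{Id}\right)$, and let $\boldsymbol{\mathcal{Q}}=\{P(n): n\in\mathbb{S}^2\}$, a set of real $3\times 3$ matrices. For an open set $\Omega\subset\mathbb{R}^d$, $1\le p\le\infty$ and $N\subset\mathbb{R}^l$, let $W^{1,p}(\Omega,N)$ be the set of $f\in W^{1,p}(\Omega,\mathbb{R}^l)$ with $f(x)\in N$ for a.e. $x\in\Omega$ (with $3\times3$ matrices regarded as elements of $\mathbb{R}^9$). A map $Q\in W^{1,p}(\Omega,\boldsymbol{\mathcal{Q}})$ is called orientable if there is an $n\in W^{1,p}(\Omega,\mathbb{S}^2)$ with $P(n)=Q$ a.e. in $\Omega$. Let $\Omega\subset\mathbb{R}^d$ be a bounded domain (a bounded, open, connected set) with boundary of class $C^0$: for every $x\in\partial\Omega$ there are $\delta>0$, an orthonormal coordinate system $y=(y',y_d)$ with origin at $x$ and a continuous function $f:\mathbb{R}^{d-1}\to\mathbb{R}$ such that $\{y\in\Omega:|y|<\delta\}=\{y\in\mathbb{R}^d: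 y_d>f(y'),\ |y|<\delta\}$. **Proposition.** Let $1\le p\le\infty$ and let $Q^{(k)}\in W^{1,p}(\Omega,\boldsymbol{\mathcal{Q}})$, $k\in\mathbb{N}$, be a sequence of orientable maps. Suppose that $Q^{(k)}$ converges to $Q$ weakly in $W^{1,p}(\Omega,\mathbb{R}^9)$ if $p<\infty$, respectively weakly* in $W^{1,\infty}(\Omega,\mathbb{R}^9)$ if $p=\infty$ (that is, $Q^{(k)}$ and each of its first-order weak partial derivatives converge weakly* in $L^\infty(\Omega,\mathbb{R}^9)$ to $Q$ and its corresponding derivative). Then $Q\in W^{1,p}(\Omega,\boldsymbol{\mathcal{Q}})$ and $Q$ is orientable, i.e. $Q=P(n)$ a.e. in $\Omega$ for some $n\in W^{1,p}(\Omega,\mathbb{S}^2)$. -/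

import Mathlib

open MeasureTheory Filter Topology Set
open scoped ENNReal ContDiff

noncomputable section

namespace LineField

/-- `ℝᵈ` with its Euclidean norm. -/
abbrev Eu (d : ℕ) : Type := EuclideanSpace ℝ (Fin d)

/-- `ℝ⁹`, the space of real `3 × 3` matrices with the Frobenius (Euclidean) norm;
the `(i, j)` coordinate is the `(i, j)` entry. -/
abbrev Mat9 : Type := EuclideanSpace ℝ (Fin 3 × Fin 3)

/-- A point of `ℝ⁹` read as a `3 × 3` matrix. -/
def asMatrix (q : Mat9) : Matrix (Fin 3) (Fin 3) ℝ := Matrix.of fun i j => q (i, j)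

/-- The unit sphere `𝕊²` of `ℝ³`. -/
def sphere2 : Set (Eu 3) := Metric.sphere 0 1

/-- `P(n) = s (n ⊗ n - Id / 3)`. -/
def projP (s : ℝ) (n : Eu 3) : Matrix (Fin 3) (Fin 3) ℝ :=
  s • (Matrix.vecMulVec n n - (1 / 3 : ℝ) • (1 : Matrix (Fin 3) (Fin 3) ℝ))

/-- The set of uniaxial matrices with scalar order parameter `s`. -/
def lineSet (s : ℝ) : Set (Matrix (Fin 3) (Fin 3) ℝ) :=
  {A | ∃ n ∈ sphere2, A = projP s n}

/-- A set of class `C⁰`: near every boundary point `x`, in orthonormal coordinates `y` centred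
at `x` with a distinguished coordinate `y_m`, the set is the strict epigraph `y_m > f(y')` of a
continuous function `f` of the remaining `d - 1` coordinates `y'`. -/
def HasC0Boundary {d : ℕ} (Ω : Set (Eu d)) : Prop :=
  ∀ x ∈ frontier Ω, ∃ δ : ℝ, 0 < δ ∧
    ∃ (b : OrthonormalBasis (Fin d) ℝ (Eu d)) (m : Fin d) (f : ({j : Fin d // j ≠ m} → ℝ) → ℝ),
      Continuous f ∧
      ∀ z : Eu d, dist z x < δ →
        (z ∈ Ω ↔ f (fun j => b.repr (z - x) j) < b.repr (z - x) m)

section Sobolev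

variable {d : ℕ} {F : Type*} [NormedAddCommGroup F] [NormedSpace ℝ F]

/-- `g` is the weak partial derivative `∂u/∂xᵢ` on `Ω`. -/
def IsWeakPartial (Ω : Set (Eu d)) (i : Fin d) (u g : Eu d → F) : Prop :=
  ∀ φ : Eu d → ℝ, ContDiff ℝ ∞ φ → HasCompactSupport φ → tsupport φ ⊆ Ω →
    ∫ x in Ω, fderiv ℝ φ x (EuclideanSpace.single i 1) • u x = -∫ x in Ω, φ x • g x

theorem integrable_test_smul {μ : Measure (Eu d)} [IsFiniteMeasureOnCompacts μ]
    {p : ℝ≥0∞} [hp : Fact (1 ≤ p)] {φ : Eu d → ℝ}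
    (hφ : Continuous φ) (hc : HasCompactSupport φ) {u : Eu d → F} (hu : MemLp u p μ) :
    Integrable (fun x => φ x • u x) μ := by
  have hul : LocallyIntegrable u μ := hu.locallyIntegrable hp.out
  exact hul.integrable_smul_left_of_hasCompactSupport hφ hc

/-- `W^{1,p}(Ω, F)`, an element being a function in `L^p(Ω, F)` together with its weak partial
derivatives, which lie in `L^p(Ω, F)` too and are determined by the function. The norm inherited
from the product, the largest of `‖u‖_p, ‖∂₁u‖_p, …, ‖∂_d u‖_p`, is equivalent to the usual one. -/
def W1p (Ω : Set (Eu d)) (p : ℝ≥0∞) [Fact (1 ≤ p)] (F : Type*) [NormedAddCommGroup F]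
    [NormedSpace ℝ F] :
    Submodule ℝ (Lp F p (volume.restrict Ω) × (Fin d → Lp F p (volume.restrict Ω))) where
  carrier := {U | ∀ i, IsWeakPartial Ω i U.1 (U.2 i)}
  zero_mem' := by
    intro i φ _ _ _
    have h : ((0 : Lp F p (volume.restrict Ω)) : Eu d → F) =ᵐ[volume.restrict Ω] 0 :=
      Lp.coeFn_zero F p _
    have e1 : ∫ x in Ω, fderiv ℝ φ x (EuclideanSpace.single i 1) •
        ((0 : Lp F p (volume.restrict Ω)) : Eu d → F) x = 0 := by
      rw [← integral_zero (Eu d) F (μ := volume.restrict Ω)]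
      exact integral_congr_ae (by filter_upwards [h] with x hx; rw [hx, Pi.zero_apply, smul_zero])
    have e2 : ∫ x in Ω, φ x • ((0 : Lp F p (volume.restrict Ω)) : Eu d → F) x = 0 := by
      rw [← integral_zero (Eu d) F (μ := volume.restrict Ω)]
      exact integral_congr_ae (by filter_upwards [h] with x hx; rw [hx, Pi.zero_apply, smul_zero])
    exact e1.trans (by rw [← neg_zero]; exact congrArg Neg.neg e2.symm)
  add_mem' := by
    intro U V hU hV i φ h1 h2 h3
    have hd : Continuous fun x => fderiv ℝ φ x (EuclideanSpace.single i 1) :=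
      (h1.continuous_fderiv (by simp)).clm_apply continuous_const
    have hdc : HasCompactSupport fun x => fderiv ℝ φ x (EuclideanSpace.single i 1) :=
      h2.fderiv_apply (𝕜 := ℝ) _
    have eU := hU i φ h1 h2 h3
    have eV := hV i φ h1 h2 h3
    have a1 : ∫ x in Ω, fderiv ℝ φ x (EuclideanSpace.single i 1) • (U + V).1 x =
        (∫ x in Ω, fderiv ℝ φ x (EuclideanSpace.single i 1) • U.1 x) +
          ∫ x in Ω, fderiv ℝ φ x (EuclideanSpace.single i 1) • V.1 x := by
      rw [← integral_add (integrable_test_smul hd hdc (Lp.memLp U.1))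
        (integrable_test_smul hd hdc (Lp.memLp V.1))]
      refine integral_congr_ae ?_
      filter_upwards [Lp.coeFn_add U.1 V.1] with x hx
      rw [Prod.fst_add, hx, Pi.add_apply, smul_add]
    have a2 : ∫ x in Ω, φ x • (U + V).2 i x =
        (∫ x in Ω, φ x • U.2 i x) + ∫ x in Ω, φ x • V.2 i x := by
      rw [← integral_add (integrable_test_smul h1.continuous h2 (Lp.memLp (U.2 i)))
        (integrable_test_smul h1.continuous h2 (Lp.memLp (V.2 i)))]
      refine integral_congr_ae ?_
      filter_upwards [Lp.coeFn_add (U.2 i) (V.2 i)] with x hx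
      rw [Prod.snd_add, Pi.add_apply, hx, Pi.add_apply, smul_add]
    rw [a1, a2, eU, eV, neg_add]
  smul_mem' := by
    intro c U hU i φ h1 h2 h3
    have eU := hU i φ h1 h2 h3
    have a1 : ∫ x in Ω, fderiv ℝ φ x (EuclideanSpace.single i 1) • (c • U).1 x =
        c • ∫ x in Ω, fderiv ℝ φ x (EuclideanSpace.single i 1) • U.1 x := by
      rw [← integral_smul]
      refine integral_congr_ae ?_
      filter_upwards [Lp.coeFn_smul c U.1] with x hx
      rw [Prod.smul_fst, hx, Pi.smul_apply, smul_comm]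
    have a2 : ∫ x in Ω, φ x • (c • U).2 i x = c • ∫ x in Ω, φ x • U.2 i x := by
      rw [← integral_smul]
      refine integral_congr_ae ?_
      filter_upwards [Lp.coeFn_smul c (U.2 i)] with x hx
      rw [Prod.smul_snd, Pi.smul_apply, hx, Pi.smul_apply, smul_comm]
    rw [a1, a2, eU, smul_neg]

variable {Ω : Set (Eu d)} {p : ℝ≥0∞} [Fact (1 ≤ p)]

/-- The function underlying an element of `W^{1,p}(Ω, F)`. -/
def toFun (U : W1p Ω p F) : Eu d → F := (U.1.1 : Eu d → F)

/-- The weak partial derivative `∂U/∂xᵢ` of an element of `W^{1,p}(Ω, F)`. -/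
def partialDeriv (U : W1p Ω p F) (i : Fin d) : Eu d → F := (U.1.2 i : Eu d → F)

end Sobolev

section Convergence

variable {d : ℕ} {F : Type*} [NormedAddCommGroup F] [InnerProductSpace ℝ F]
  {Ω : Set (Eu d)} {p : ℝ≥0∞} [Fact (1 ≤ p)]

/-- Weak convergence in the normed space `W^{1,p}(Ω, F)`. -/
def WeaklyConverges (U : ℕ → W1p Ω p F) (V : W1p Ω p F) : Prop :=
  ∀ L : W1p Ω p F →L[ℝ] ℝ, Tendsto (fun k => L (U k)) atTop (𝓝 (L V))

/-- Weak* convergence in `W^{1,∞}(Ω, F)`: the functions and all their weak partial derivatives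
converge weakly* in `L^∞ = (L^1)*`. -/
def WeakStarConverges (U : ℕ → W1p Ω p F) (V : W1p Ω p F) : Prop :=
  ∀ h : Eu d → F, Integrable h (volume.restrict Ω) →
    Tendsto (fun k => ∫ x in Ω, inner ℝ (h x) (toFun (U k) x)) atTop
      (𝓝 (∫ x in Ω, inner ℝ (h x) (toFun V x))) ∧
    ∀ i : Fin d, Tendsto (fun k => ∫ x in Ω, inner ℝ (h x) (partialDeriv (U k) i x)) atTop
      (𝓝 (∫ x in Ω, inner ℝ (h x) (partialDeriv V i x)))

end Convergence

section Orientable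

variable {d : ℕ} {Ω : Set (Eu d)} {p : ℝ≥0∞} [Fact (1 ≤ p)]

/-- `Q ∈ W^{1,p}(Ω, 𝒬)`: the matrix field takes values in the set of line-field matrices. -/
def IsLineField (s : ℝ) (Q : W1p Ω p Mat9) : Prop :=
  ∀ᵐ x ∂(volume.restrict Ω), asMatrix (toFun Q x) ∈ lineSet s

/-- `n ∈ W^{1,p}(Ω, 𝕊²)`. -/
def IsSphereValued (n : W1p Ω p (Eu 3)) : Prop :=
  ∀ᵐ x ∂(volume.restrict Ω), toFun n x ∈ sphere2

/-- A line field `Q ∈ W^{1,p}(Ω, 𝒬)` is orientable if `Q = P(n)` almost everywhere for some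
`n ∈ W^{1,p}(Ω, 𝕊²)`. -/
def IsOrientable (s : ℝ) (Q : W1p Ω p Mat9) : Prop :=
  IsLineField s Q ∧ ∃ n : W1p Ω p (Eu 3), IsSphereValued n ∧
    ∀ᵐ x ∂(volume.restrict Ω), projP s (toFun n x) = asMatrix (toFun Q x)

end Orientable

end LineField

end

/-!
Let `n_k` orient `Q_k`. Differentiating `n ⊗ n = s⁻¹ Q + Id / 3` and contracting with the unit
vector `n`, which is orthogonal to `∂ᵢn`, gives `∂ᵢn = s⁻¹ (∂ᵢQ) n`. Weak convergence bounds
`∂ᵢQ_k` in `L¹` on compact sets, hence also `∂ᵢn_k`, and Rellich's theorem extracts from `n_k` a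
subsequence converging almost everywhere to some `n`; by continuity of `P`, `P(n) = Q`. In
`∂ᵢn_k = s⁻¹ (∂ᵢQ_k) n_k` the right side is the product of a weakly convergent factor and a bounded,
almost everywhere convergent one, so it passes to the limit and `∂ᵢn = s⁻¹ (∂ᵢQ) n ∈ L^p`. This is
what covers `p = 1`, where a bound on `∂ᵢn_k` alone would only make `∂ᵢn` a measure.
-/

noncomputable section

namespace LineField

section WeakL1

variable {α F : Type*} {m : MeasurableSpace α} {μ : Measure α}
  [NormedAddCommGroup F]

theorem isClosed_setOf_ae_norm_le_one : IsClosed {h : Lp F 1 μ | ∀ᵐ x ∂μ, ‖h x‖ ≤ 1} := by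
  refine IsSeqClosed.isClosed fun f g hf hg => ?_
  obtain ⟨ns, -, hns⟩ := (tendstoInMeasure_of_tendsto_Lp hg).exists_seq_tendsto_ae
  filter_upwards [hns, ae_all_iff.2 fun i => hf (ns i)] with x hx h1
  exact le_of_tendsto' hx.norm h1

theorem norm_shrink_le [NormedSpace ℝ F] {v v₀ : F} (hv : ‖v‖ ≤ 1) (hv₀ : ‖v₀‖ ≤ 1) :
    (‖(1 - ‖v‖) • v₀‖ ≤ 1 ∧ ‖(1 - ‖v‖) • v₀ + v‖ ≤ 1) ∧
      ‖(1 - ‖v‖) • v₀ - v₀‖ ≤ 2 * ‖v‖ ∧ ‖(1 - ‖v‖) • v₀ + v - v₀‖ ≤ 2 * ‖v‖ := by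
  have hle : ‖(1 - ‖v‖) • v₀‖ ≤ 1 - ‖v‖ := by
    rw [norm_smul, Real.norm_of_nonneg (sub_nonneg.2 hv)]
    exact mul_le_of_le_one_right (sub_nonneg.2 hv) hv₀
  have hdist : ‖(1 - ‖v‖) • v₀ - v₀‖ ≤ ‖v‖ := by
    rw [sub_smul, one_smul, sub_sub_cancel_left, norm_neg, norm_smul, norm_norm]
    exact mul_le_of_le_one_right (norm_nonneg _) hv₀
  have hnonneg := norm_nonneg v
  refine ⟨⟨by linarith, (norm_add_le _ _).trans (by linarith)⟩, by linarith, ?_⟩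
  rw [add_sub_right_comm]
  exact (norm_add_le _ _).trans (by linarith)

theorem norm_inv_norm_smul_le_one [NormedSpace ℝ F] (v : F) : ‖‖v‖⁻¹ • v‖ ≤ 1 := by
  rw [norm_smul, norm_inv, norm_norm]
  exact inv_mul_le_one

theorem memLp_top_inv_norm_smul [NormedSpace ℝ F] {g : α → F} (hg : AEStronglyMeasurable g μ) :
    MemLp (fun x => ‖g x‖⁻¹ • g x) ∞ μ :=
  memLp_top_of_bound (hg.norm.aemeasurable.inv.aestronglyMeasurable.smul hg) 1
    (ae_of_all _ fun x => norm_inv_norm_smul_le_one (g x))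

variable [InnerProductSpace ℝ F]

theorem inner_inv_norm_smul_self (v : F) : inner ℝ (‖v‖⁻¹ • v) v = ‖v‖ := by
  rw [real_inner_smul_left, real_inner_self_eq_norm_mul_norm, ← mul_assoc,
    inv_mul_mul_self]

theorem integrable_inner_of_memLp_top {h g : α → F} (hh : MemLp h ∞ μ) (hg : Integrable g μ) :
    Integrable (fun x => inner ℝ (h x) (g x)) μ :=
  memLp_one_iff_integrable.1
    ((innerSL ℝ).memLp_of_bilin 1 hh (memLp_one_iff_integrable.2 hg))

theorem tendsto_integral_inner_of_ae_tendsto {h : ℕ → α → F} {h' g : α → F} {C : ℝ}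
    (hh : ∀ k, AEStronglyMeasurable (h k) μ) (hC : ∀ k, ∀ᵐ x ∂μ, ‖h k x‖ ≤ C)
    (hlim : ∀ᵐ x ∂μ, Tendsto (fun k => h k x) atTop (𝓝 (h' x))) (hg : Integrable g μ) :
    Tendsto (fun k => ∫ x, inner ℝ (h k x) (g x) ∂μ) atTop (𝓝 (∫ x, inner ℝ (h' x) (g x) ∂μ)) := by
  refine tendsto_integral_of_dominated_convergence (fun x => C * ‖g x‖)
    (fun k => (hh k).inner hg.1) (hg.norm.const_mul C) (fun k => ?_) ?_
  · filter_upwards [hC k] with x hx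
    exact (norm_inner_le_norm _ _).trans (by gcongr)
  · filter_upwards [hlim] with x hx
    exact hx.inner tendsto_const_nhds

theorem isClosed_setOf_abs_integral_inner_le {g : α → F} (hg : Integrable g μ) (ε : ℝ) :
    IsClosed {h : {h : Lp F 1 μ | ∀ᵐ x ∂μ, ‖h x‖ ≤ 1} |
      |∫ x, inner ℝ ((h : Lp F 1 μ) x) (g x) ∂μ| ≤ ε} := by
  refine IsSeqClosed.isClosed fun f h hf hh => ?_
  obtain ⟨ns, -, hns⟩ := (tendstoInMeasure_of_tendsto_Lp
    ((continuous_subtype_val.tendsto _).comp hh)).exists_seq_tendsto_ae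
  exact le_of_tendsto' (tendsto_integral_inner_of_ae_tendsto
    (fun i => Lp.aestronglyMeasurable (f (ns i)).1) (fun i => (f (ns i)).2) hns hg).abs
    fun i => hf (ns i)

/-- Weak convergence `g k ⇀ g'` in `L¹(μ)`, the dual of `L¹` being represented by `L^∞`. -/
def TendstoWeakL1 (μ : Measure α) (g : ℕ → α → F) (g' : α → F) : Prop :=
  ∀ h : α → F, MemLp h ∞ μ →
    Tendsto (fun k => ∫ x, inner ℝ (h x) (g k x) ∂μ) atTop (𝓝 (∫ x, inner ℝ (h x) (g' x) ∂μ))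

namespace TendstoWeakL1

variable {f g : ℕ → α → F} {g' : α → F}

theorem comp_strictMono (hg : TendstoWeakL1 μ g g') {ns : ℕ → ℕ} (hns : StrictMono ns) :
    TendstoWeakL1 μ (fun k => g (ns k)) g' :=
  fun h hh => (hg h hh).comp hns.tendsto_atTop

theorem const_smul (hg : TendstoWeakL1 μ g g') (c : ℝ) :
    TendstoWeakL1 μ (fun k => c • g k) (c • g') := by
  intro h hh
  simp only [Pi.smul_apply, real_inner_smul_right, integral_const_mul]
  exact (hg h hh).const_mul c

theorem sub_limit (hg : ∀ k, Integrable (g k) μ) (hg' : Integrable g' μ)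
    (hw : TendstoWeakL1 μ g g') : TendstoWeakL1 μ (fun k => g k - g') 0 := by
  intro h hh
  have hdiff := (hw h hh).sub_const (∫ x, inner ℝ (h x) (g' x) ∂μ)
  simp only [Pi.sub_apply, Pi.zero_apply, inner_zero_right, integral_zero, sub_self] at hdiff ⊢
  refine hdiff.congr fun k => ?_
  simp only [inner_sub_right]
  exact (integral_sub (integrable_inner_of_memLp_top hh (hg k))
    (integrable_inner_of_memLp_top hh hg')).symm

theorem of_ae_tendsto [IsFiniteMeasure μ] {C : ℝ} (hg : ∀ k, AEStronglyMeasurable (g k) μ)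
    (hC : ∀ k, ∀ᵐ x ∂μ, ‖g k x‖ ≤ C)
    (hlim : ∀ᵐ x ∂μ, Tendsto (fun k => g k x) atTop (𝓝 (g' x))) : TendstoWeakL1 μ g g' := by
  intro h hh
  simpa only [real_inner_comm] using
    tendsto_integral_inner_of_ae_tendsto hg hC hlim (hh.integrable le_top)

theorem ae_eq {u v : α → F} (hu : Integrable u μ) (hv : Integrable v μ)
    (hgu : TendstoWeakL1 μ g u) (hgv : TendstoWeakL1 μ g v) : u =ᵐ[μ] v := by
  have hh := memLp_top_inv_norm_smul (hu.sub hv).1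
  have hlim := tendsto_nhds_unique (hgu _ hh) (hgv _ hh)
  rw [← sub_eq_zero, ← integral_sub (integrable_inner_of_memLp_top hh hu)
    (integrable_inner_of_memLp_top hh hv)] at hlim
  simp only [← inner_sub_right, ← Pi.sub_apply, inner_inv_norm_smul_self] at hlim
  have hzero := (integral_eq_zero_iff_of_nonneg (fun x => norm_nonneg _) (hu.sub hv).norm).1 hlim
  filter_upwards [hzero] with x hx
  exact sub_eq_zero.1 (norm_eq_zero.1 hx)

theorem exists_integral_norm_le [CompleteSpace F] (hg : ∀ k, Integrable (g k) μ)
    (hw : TendstoWeakL1 μ g g') : ∃ C : ℝ, ∀ k, ∫ x, ‖g k x‖ ∂μ ≤ C := by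
  let T : ℕ → Lp F ∞ μ →L[ℝ] ℝ := fun k =>
    ((innerSL ℝ).lpPairing μ ∞ 1).flip ((memLp_one_iff_integrable.2 (hg k)).toLp (g k))
  have hT : ∀ k (h : Lp F ∞ μ), T k h = ∫ x, inner ℝ (h x) (g k x) ∂μ := fun k h => by
    simp only [T, ContinuousLinearMap.flip_apply, ContinuousLinearMap.lpPairing_eq_integral]
    refine integral_congr_ae ?_
    filter_upwards [(memLp_one_iff_integrable.2 (hg k)).coeFn_toLp] with x hx
    rw [hx, innerSL_apply_apply]
  obtain ⟨C, hC⟩ := banach_steinhaus (g := T) fun h => by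
    obtain ⟨B, hB⟩ := (hw h (Lp.memLp h)).norm.bddAbove_range
    exact ⟨B, fun k => (hT k h).symm ▸ hB (mem_range_self k)⟩
  refine ⟨C, fun k => ?_⟩
  have hh := memLp_top_inv_norm_smul (hg k).1
  calc ∫ x, ‖g k x‖ ∂μ = ∫ x, inner ℝ (‖g k x‖⁻¹ • g k x) (g k x) ∂μ := by
        simp only [inner_inv_norm_smul_self]
    _ = T k (hh.toLp _) := by
        rw [hT]
        refine integral_congr_ae ?_
        filter_upwards [hh.coeFn_toLp] with x hx
        rw [hx]
    _ ≤ ‖T k‖ * ‖hh.toLp _‖ := (le_abs_self _).trans ((T k).le_opNorm _)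
    _ ≤ C * 1 := by
        refine mul_le_mul (hC k) ?_ (norm_nonneg _) ((norm_nonneg _).trans (hC k))
        rw [Lp.norm_toLp, eLpNorm_exponent_top]
        exact ENNReal.toReal_le_of_le_ofReal zero_le_one
          (eLpNormEssSup_le_of_ae_bound (ae_of_all _ fun x => norm_inv_norm_smul_le_one _))
    _ = C := mul_one C

theorem exists_ball_integral_inner_le [IsFiniteMeasure μ] [CompleteSpace F]
    (hf : ∀ k, Integrable (f k) μ) (hw : TendstoWeakL1 μ f 0) {ε : ℝ} (hε : 0 < ε) :
    ∃ h₀ : α → F, AEStronglyMeasurable h₀ μ ∧ (∀ᵐ x ∂μ, ‖h₀ x‖ ≤ 1) ∧ ∃ r > 0, ∀ᶠ k in atTop,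
      ∀ h : α → F, AEStronglyMeasurable h μ → (∀ᵐ x ∂μ, ‖h x‖ ≤ 1) →
        ∫ x, ‖h x - h₀ x‖ ∂μ < r → |∫ x, inner ℝ (h x) (f k x) ∂μ| ≤ ε := by
  let X : Set (Lp F 1 μ) := {h | ∀ᵐ x ∂μ, ‖h x‖ ≤ 1}
  have : CompleteSpace X := isClosed_setOf_ae_norm_le_one.completeSpace_coe
  have : Nonempty X := ⟨⟨0, by
    filter_upwards [Lp.coeFn_zero F 1 μ] with x hx
    simp only [hx, Pi.zero_apply, norm_zero, zero_le_one]⟩⟩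
  let A : ℕ → Set X := fun N =>
    ⋂ k ≥ N, {h | |∫ x, inner ℝ ((h : Lp F 1 μ) x) (f k x) ∂μ| ≤ ε}
  have hA : ⋃ N, A N = univ := by
    refine eq_univ_of_forall fun h => ?_
    have hlim := hw h (memLp_top_of_bound (Lp.aestronglyMeasurable h.1) 1 h.2)
    simp only [Pi.zero_apply, inner_zero_right, integral_zero] at hlim
    obtain ⟨N, hN⟩ := eventually_atTop.1 (hlim.abs.eventually_lt_const (abs_zero.trans_lt hε))
    exact mem_iUnion.2 ⟨N, mem_iInter₂.2 fun k hk => (hN k hk).le⟩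
  obtain ⟨N, h₀, hint⟩ := nonempty_interior_of_iUnion_of_closed
    (fun N => isClosed_biInter fun k _ => isClosed_setOf_abs_integral_inner_le (hf k) ε) hA
  obtain ⟨r, hr, hball⟩ := Metric.mem_nhds_iff.1 (mem_interior_iff_mem_nhds.1 hint)
  refine ⟨h₀, Lp.aestronglyMeasurable _, h₀.2, r, hr, eventually_atTop.2 ⟨N, ?_⟩⟩
  intro k hk h hm h1 hd
  have hi : Integrable h μ := Integrable.of_bound hm 1 h1
  have hcoe := (memLp_one_iff_integrable.2 hi).coeFn_toLp
  have hX : (memLp_one_iff_integrable.2 hi).toLp h ∈ X := by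
    filter_upwards [hcoe, h1] with x hx hx1
    rwa [hx]
  have hmem : (⟨_, hX⟩ : X) ∈ A N := by
    refine hball ?_
    rw [Metric.mem_ball, Subtype.dist_eq, L1.dist_eq_integral_dist]
    refine lt_of_eq_of_lt (integral_congr_ae ?_) hd
    filter_upwards [hcoe] with x hx
    rw [hx, dist_eq_norm]
  refine le_of_eq_of_le (congrArg _ (integral_congr_ae ?_)) (mem_iInter₂.1 hmem k hk)
  filter_upwards [hcoe] with x hx
  rw [hx]

/-- The Vitali–Hahn–Saks phenomenon: a weakly null sequence is equi-integrable. -/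
theorem equiintegrable [IsFiniteMeasure μ] [CompleteSpace F]
    (hf : ∀ k, Integrable (f k) μ) (hw : TendstoWeakL1 μ f 0) {ε : ℝ} (hε : 0 < ε) :
    ∃ δ > 0, ∀ᶠ k in atTop, ∀ h : α → F, AEStronglyMeasurable h μ → (∀ᵐ x ∂μ, ‖h x‖ ≤ 1) →
      ∫ x, ‖h x‖ ∂μ < δ → |∫ x, inner ℝ (h x) (f k x) ∂μ| ≤ ε := by
  obtain ⟨h₀, hm₀, h₀1, r, hr, hball⟩ := hw.exists_ball_integral_inner_le hf (half_pos hε)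
  refine ⟨r / 2, half_pos hr, hball.mono fun k hk h hm h1 hd => ?_⟩
  -- `h` is the difference of two functions of the unit ball that are close to `h₀`.
  let b : α → F := fun x => (1 - ‖h x‖) • h₀ x
  have hbm : AEStronglyMeasurable b μ := (aestronglyMeasurable_const.sub hm.norm).smul hm₀
  have ham : AEStronglyMeasurable (b + h) μ := hbm.add hm
  have hsplit : ∀ᵐ x ∂μ, (‖b x‖ ≤ 1 ∧ ‖b x + h x‖ ≤ 1) ∧
      ‖b x - h₀ x‖ ≤ 2 * ‖h x‖ ∧ ‖b x + h x - h₀ x‖ ≤ 2 * ‖h x‖ := by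
    filter_upwards [h1, h₀1] with x hx hx₀
    exact norm_shrink_le hx hx₀
  have hb1 : ∀ᵐ x ∂μ, ‖b x‖ ≤ 1 := hsplit.mono fun x hx => hx.1.1
  have ha1 : ∀ᵐ x ∂μ, ‖(b + h) x‖ ≤ 1 := hsplit.mono fun x hx => hx.1.2
  have hclose : ∀ c : α → F, AEStronglyMeasurable c μ → (∀ᵐ x ∂μ, ‖c x‖ ≤ 1) →
      (∀ᵐ x ∂μ, ‖c x - h₀ x‖ ≤ 2 * ‖h x‖) → |∫ x, inner ℝ (c x) (f k x) ∂μ| ≤ ε / 2 := by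
    intro c hcm hc1 hc₀
    refine hk c hcm hc1 (lt_of_le_of_lt (integral_mono_ae ?_ ?_ hc₀) ?_)
    · exact ((Integrable.of_bound hcm 1 hc1).sub (Integrable.of_bound hm₀ 1 h₀1)).norm
    · exact (Integrable.of_bound hm 1 h1).norm.const_mul 2
    · rw [integral_const_mul]
      linarith
  have hsub : ∫ x, inner ℝ (h x) (f k x) ∂μ =
      ∫ x, inner ℝ ((b + h) x) (f k x) ∂μ - ∫ x, inner ℝ (b x) (f k x) ∂μ := by
    rw [← integral_sub (integrable_inner_of_memLp_top (memLp_top_of_bound ham 1 ha1) (hf k))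
      (integrable_inner_of_memLp_top (memLp_top_of_bound hbm 1 hb1) (hf k))]
    simp only [Pi.add_apply, ← inner_sub_left, add_sub_cancel_left]
  rw [hsub]
  calc _ ≤ _ := abs_sub _ _
    _ ≤ ε / 2 + ε / 2 := add_le_add (hclose _ ham ha1 (hsplit.mono fun x hx => hx.2.2))
        (hclose b hbm hb1 (hsplit.mono fun x hx => hx.2.1))
    _ = ε := add_halves ε

theorem tendsto_integral_inner_of_tendsto_zero [IsFiniteMeasure μ] [CompleteSpace F]
    (hf : ∀ k, Integrable (f k) μ) (hw : TendstoWeakL1 μ f 0) {h : ℕ → α → F} {C : ℝ}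
    (hh : ∀ k, AEStronglyMeasurable (h k) μ) (hC : ∀ k, ∀ᵐ x ∂μ, ‖h k x‖ ≤ C)
    (hlim : ∀ᵐ x ∂μ, Tendsto (fun k => h k x) atTop (𝓝 0)) :
    Tendsto (fun k => ∫ x, inner ℝ (h k x) (f k x) ∂μ) atTop (𝓝 0) := by
  have hc : 0 < |C| + 1 := by positivity
  have hscaled : Tendsto (fun k => ∫ x, inner ℝ ((|C| + 1)⁻¹ • h k x) (f k x) ∂μ) atTop (𝓝 0) := by
    have hL1 : Tendsto (fun k => ∫ x, ‖(|C| + 1)⁻¹ • h k x‖ ∂μ) atTop (𝓝 0) := by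
      rw [← integral_zero α ℝ (μ := μ)]
      refine tendsto_integral_of_dominated_convergence (fun _ => (|C| + 1)⁻¹ * C)
        (fun k => ((hh k).const_smul _).norm) (integrable_const _) (fun k => ?_) ?_
      · filter_upwards [hC k] with x hx
        rw [norm_norm, norm_smul, Real.norm_of_nonneg (inv_nonneg.2 hc.le)]
        gcongr
      · filter_upwards [hlim] with x hx
        simpa only [smul_zero, norm_zero] using (hx.const_smul (|C| + 1)⁻¹).norm
    refine Metric.tendsto_nhds.2 fun ε hε => ?_
    obtain ⟨δ, hδ, hequi⟩ := hw.equiintegrable hf (half_pos hε)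
    filter_upwards [hequi, hL1.eventually_lt_const hδ] with k hk hkδ
    rw [dist_zero_right, Real.norm_eq_abs]
    refine (hk _ ((hh k).const_smul _) ?_ hkδ).trans_lt (half_lt_self hε)
    filter_upwards [hC k] with x hx
    rw [Pi.smul_apply, norm_smul, Real.norm_of_nonneg (inv_nonneg.2 hc.le), inv_mul_le_one₀ hc]
    linarith [le_abs_self C]
  simpa only [real_inner_smul_left, integral_const_mul, mul_inv_cancel_left₀ hc.ne', mul_zero]
    using hscaled.const_mul (|C| + 1)

theorem tendsto_integral_inner [IsFiniteMeasure μ] [CompleteSpace F]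
    (hg : ∀ k, Integrable (g k) μ) (hg' : Integrable g' μ) (hw : TendstoWeakL1 μ g g')
    {h : ℕ → α → F} {h' : α → F} {C : ℝ} (hh : ∀ k, AEStronglyMeasurable (h k) μ)
    (hC : ∀ k, ∀ᵐ x ∂μ, ‖h k x‖ ≤ C)
    (hlim : ∀ᵐ x ∂μ, Tendsto (fun k => h k x) atTop (𝓝 (h' x))) :
    Tendsto (fun k => ∫ x, inner ℝ (h k x) (g k x) ∂μ) atTop
      (𝓝 (∫ x, inner ℝ (h' x) (g' x) ∂μ)) := by
  have hm' : AEStronglyMeasurable h' μ := aestronglyMeasurable_of_tendsto_ae atTop hh hlim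
  have hC' : ∀ᵐ x ∂μ, ‖h' x‖ ≤ C := by
    filter_upwards [hlim, ae_all_iff.2 hC] with x hx hxC
    exact le_of_tendsto' hx.norm hxC
  have hdm : ∀ k, AEStronglyMeasurable (h k - h') μ := fun k => (hh k).sub hm'
  have hdC : ∀ k, ∀ᵐ x ∂μ, ‖(h k - h') x‖ ≤ C + C := fun k => by
    filter_upwards [hC k, hC'] with x hx hx'
    exact (norm_sub_le _ _).trans (add_le_add hx hx')
  have hdlim : ∀ᵐ x ∂μ, Tendsto (fun k => (h k - h') x) atTop (𝓝 0) := by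
    filter_upwards [hlim] with x hx
    exact tendsto_sub_nhds_zero_iff.2 hx
  have hcross := (hw.sub_limit hg hg').tendsto_integral_inner_of_tendsto_zero
    (fun k => (hg k).sub hg') hdm hdC hdlim
  have hstrong := tendsto_integral_inner_of_ae_tendsto hdm hdC hdlim hg'
  have hfixed := hw h' (memLp_top_of_bound hm' C hC')
  have hsum := (hcross.add hstrong).add hfixed
  simp only [inner_zero_left, integral_zero, zero_add] at hsum
  refine hsum.congr fun k => ?_
  have hd : MemLp (h k - h') ∞ μ := memLp_top_of_bound (hdm k) (C + C) (hdC k)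
  have hi_cross := integrable_inner_of_memLp_top hd ((hg k).sub hg')
  have hi_strong := integrable_inner_of_memLp_top hd hg'
  have hi_fixed := integrable_inner_of_memLp_top (memLp_top_of_bound hm' C hC') (hg k)
  rw [← integral_add hi_cross hi_strong, ← integral_add (hi_cross.fun_add hi_strong) hi_fixed]
  refine integral_congr_ae (ae_of_all _ fun x => ?_)
  simp only [Pi.sub_apply, inner_sub_left, inner_sub_right]
  ring

end TendstoWeakL1

end WeakL1

section Mollifier

variable {d : ℕ} {F : Type*} [NormedAddCommGroup F] [NormedSpace ℝ F]

/-- A smooth bump supported in the closed ball of radius `1 / (j + 1)`. -/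
def bump (d j : ℕ) : ContDiffBump (0 : Eu d) where
  rIn := 1 / (2 * (j + 1))
  rOut := 1 / (j + 1)
  rIn_pos := by positivity
  rIn_lt_rOut := one_div_lt_one_div_of_lt (by positivity) (by linarith [j.cast_nonneg (α := ℝ)])

/-- The standard mollifiers. -/
def mollifier (d j : ℕ) : Eu d → ℝ := (bump d j).normed volume

theorem contDiff_mollifier (j : ℕ) : ContDiff ℝ ∞ (mollifier d j) := (bump d j).contDiff_normed

theorem hasCompactSupport_mollifier (j : ℕ) : HasCompactSupport (mollifier d j) :=
  (bump d j).hasCompactSupport_normed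

theorem continuous_mollifier (j : ℕ) : Continuous (mollifier d j) :=
  (contDiff_mollifier j).continuous

theorem integrable_mollifier (j : ℕ) : Integrable (mollifier d j) := (bump d j).integrable_normed

theorem mollifier_nonneg (j : ℕ) (x : Eu d) : 0 ≤ mollifier d j x := (bump d j).nonneg_normed x

theorem mollifier_sub_comm (j : ℕ) (x y : Eu d) :
    mollifier d j (x - y) = mollifier d j (y - x) := by
  rw [← neg_sub]
  exact (bump d j).normed_neg (y - x)

theorem integral_mollifier (j : ℕ) : ∫ x, mollifier d j x = 1 := (bump d j).integral_normed

theorem lintegral_enorm_mollifier (j : ℕ) : ∫⁻ x, ‖mollifier d j x‖ₑ = 1 := by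
  have h := ofReal_integral_norm_eq_lintegral_enorm (integrable_mollifier (d := d) j)
  simp only [Real.norm_of_nonneg (mollifier_nonneg j _), integral_mollifier] at h
  rw [← h, ENNReal.ofReal_one]

theorem mollifier_eq_zero {j : ℕ} {x : Eu d} (h : 1 / ((j : ℝ) + 1) < ‖x‖) :
    mollifier d j x = 0 := by
  refine Function.notMem_support.1 fun hx => ?_
  rw [mollifier, ContDiffBump.support_normed_eq, mem_ball_zero_iff] at hx
  exact hx.not_gt h

/-- The convolution of `u` with the `j`-th mollifier. -/
def mollify (j : ℕ) (u : Eu d → F) : Eu d → F :=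
  convolution (mollifier d j) u (ContinuousLinearMap.lsmul ℝ ℝ) volume

theorem mollify_apply (j : ℕ) (u : Eu d → F) (x : Eu d) :
    mollify j u x = ∫ t, mollifier d j t • u (x - t) := rfl

theorem mollify_apply_sub (j : ℕ) (u : Eu d → F) (x : Eu d) :
    mollify j u x = ∫ t, mollifier d j (x - t) • u t :=
  convolution_eq_swap (ContinuousLinearMap.lsmul ℝ ℝ)

theorem integrable_mollifier_sub_smul {u : Eu d → F} (hu : LocallyIntegrable u) (j : ℕ)
    (x : Eu d) : Integrable fun t => mollifier d j (x - t) • u t :=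
  hu.integrable_smul_left_of_hasCompactSupport
    ((continuous_mollifier j).comp (continuous_const.sub continuous_id))
    ((hasCompactSupport_mollifier j).comp_homeomorph (Homeomorph.subLeft x))

theorem integrable_mollifier_smul_sub {u : Eu d → F} (hu : LocallyIntegrable u) (j : ℕ)
    (x : Eu d) : Integrable fun t => mollifier d j t • u (x - t) := by
  simpa only [sub_sub_cancel] using (integrable_mollifier_sub_smul hu j x).comp_sub_left x

theorem contDiff_mollify {u : Eu d → F} (hu : LocallyIntegrable u) (j : ℕ) :
    ContDiff ℝ ∞ (mollify j u) :=
  (hasCompactSupport_mollifier j).contDiff_convolution_left _ (contDiff_mollifier j) hu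

theorem ae_tendsto_mollify [CompleteSpace F] {u : Eu d → F} (hu : LocallyIntegrable u) :
    ∀ᵐ x, Tendsto (fun j => mollify j u x) atTop (𝓝 (u x)) := by
  refine ContDiffBump.ae_convolution_tendsto_right_of_locallyIntegrable (φ := bump d) (K := 2)
    (tendsto_one_div_add_atTop_nhds_zero_nat (𝕜 := ℝ)) (Eventually.of_forall fun j => ?_) hu
  change 1 / ((j : ℝ) + 1) ≤ 2 * (1 / (2 * (j + 1)))
  exact le_of_eq (by field_simp)

theorem norm_mollify_le {u : Eu d → F} {M : ℝ} (hu : ∀ᵐ x, ‖u x‖ ≤ M) (j : ℕ) (x : Eu d) :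
    ‖mollify j u x‖ ≤ M := by
  rw [mollify_apply_sub]
  have hint : Integrable fun t => mollifier d j (x - t) := (integrable_mollifier j).comp_sub_left x
  have hle := norm_integral_le_of_norm_le (f := fun t => mollifier d j (x - t) • u t)
    (hint.mul_const M) (hu.mono fun t ht => by
      rw [norm_smul, Real.norm_of_nonneg (mollifier_nonneg _ _)]
      exact mul_le_mul_of_nonneg_left ht (mollifier_nonneg _ _))
  rwa [integral_mul_const, integral_sub_left_eq_self (mollifier d j) volume x, integral_mollifier,
    one_mul] at hle

theorem lintegral_enorm_mollify_le {u : Eu d → F} (hu : AEStronglyMeasurable u) (j : ℕ) :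
    ∫⁻ x, ‖mollify j u x‖ₑ ≤ ∫⁻ x, ‖u x‖ₑ := by
  have hm : AEMeasurable (fun z : Eu d × Eu d => ‖mollifier d j z.2 • u (z.1 - z.2)‖ₑ)
      (volume.prod volume) :=
    ((integrable_mollifier j).1.convolution_integrand (ContinuousLinearMap.lsmul ℝ ℝ) hu).enorm
  calc ∫⁻ x, ‖mollify j u x‖ₑ
      ≤ ∫⁻ x, ∫⁻ t, ‖mollifier d j t • u (x - t)‖ₑ :=
        lintegral_mono fun x => enorm_integral_le_lintegral_enorm _
    _ = ∫⁻ t, ∫⁻ x, ‖mollifier d j t • u (x - t)‖ₑ := lintegral_lintegral_swap hm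
    _ = ∫⁻ t, ‖mollifier d j t‖ₑ * ∫⁻ x, ‖u x‖ₑ := by
        refine lintegral_congr fun t => ?_
        simp only [enorm_smul]
        rw [lintegral_const_mul' _ _ enorm_ne_top,
          lintegral_sub_right_eq_self (fun x => ‖u x‖ₑ) t]
    _ = ∫⁻ x, ‖u x‖ₑ := by
        rw [lintegral_mul_const _ (continuous_mollifier j).enorm.measurable,
          lintegral_enorm_mollifier, one_mul]

theorem integral_mollify_smul_comm [CompleteSpace F] {g : Eu d → ℝ} {A : Eu d → F} {M : ℝ}
    (hg : Integrable g) (hA : AEStronglyMeasurable A) (hM : ∀ᵐ x, ‖A x‖ ≤ M) (j : ℕ) :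
    ∫ x, mollify j g x • A x = ∫ x, g x • mollify j A x := by
  have hi : Integrable (fun z : Eu d × Eu d => (mollifier d j (z.1 - z.2) * g z.2) • A z.1)
      (volume.prod volume) := by
    refine Integrable.smul_bdd ?_ M hA.comp_fst ?_
    · have h := hg.convolution_integrand (ContinuousLinearMap.mul ℝ ℝ) (integrable_mollifier j)
      simpa only [ContinuousLinearMap.mul_apply', mul_comm] using h
    · exact Measure.quasiMeasurePreserving_fst.ae hM
  calc ∫ x, mollify j g x • A x
      = ∫ x, ∫ t, (mollifier d j (x - t) * g t) • A x := by
        simp only [mollify_apply_sub, ← integral_smul_const, smul_eq_mul]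
    _ = ∫ t, ∫ x, (mollifier d j (x - t) * g t) • A x := integral_integral_swap hi
    _ = ∫ t, g t • mollify j A t := by
        simp only [mollify_apply_sub, ← integral_smul, smul_smul, mul_comm, mollifier_sub_comm j]

theorem tendsto_integral_mollify_smul [CompleteSpace F] {g : Eu d → ℝ} {A : Eu d → F} {M : ℝ}
    (hg : Integrable g) (hA : AEStronglyMeasurable A) (hM : ∀ᵐ x, ‖A x‖ ≤ M) :
    Tendsto (fun j => ∫ x, mollify j g x • A x) atTop (𝓝 (∫ x, g x • A x)) := by
  have hAl : LocallyIntegrable A := (memLp_top_of_bound hA M hM).locallyIntegrable le_top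
  simp only [integral_mollify_smul_comm hg hA hM]
  refine tendsto_integral_of_dominated_convergence (fun x => ‖g x‖ * M)
    (fun j => hg.1.smul (contDiff_mollify hAl j).continuous.aestronglyMeasurable)
    (hg.norm.mul_const M) (fun j => ae_of_all _ fun x => ?_) ?_
  · rw [norm_smul]
    exact mul_le_mul_of_nonneg_left (norm_mollify_le hM j x) (norm_nonneg _)
  · filter_upwards [ae_tendsto_mollify hAl] with x hx
    exact hx.const_smul _

end Mollifier

section TestFunction

variable {d : ℕ} {Ω : Set (Eu d)} {F : Type*} [NormedAddCommGroup F] [NormedSpace ℝ F]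

/-- The classical partial derivative `∂f/∂xᵢ`. -/
def pderiv (i : Fin d) (f : Eu d → F) (x : Eu d) : F :=
  fderiv ℝ f x (EuclideanSpace.single i 1)

theorem pderiv_mul {f g : Eu d → ℝ} {x : Eu d} (hf : DifferentiableAt ℝ f x)
    (hg : DifferentiableAt ℝ g x) (i : Fin d) :
    pderiv i (fun y => f y * g y) x = f x * pderiv i g x + g x * pderiv i f x := by
  simp only [pderiv, fderiv_fun_mul hf hg, add_apply, smul_apply, smul_eq_mul]

/-- The test functions on `Ω`: smooth functions with compact support contained in `Ω`. -/
structure IsTestFunction (Ω : Set (Eu d)) (φ : Eu d → ℝ) : Prop where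
  contDiff : ContDiff ℝ ∞ φ
  hasCompactSupport : HasCompactSupport φ
  tsupport_subset : tsupport φ ⊆ Ω

namespace IsTestFunction

variable {φ : Eu d → ℝ}

theorem continuous (hφ : IsTestFunction Ω φ) : Continuous φ := hφ.contDiff.continuous

theorem differentiable (hφ : IsTestFunction Ω φ) : Differentiable ℝ φ :=
  hφ.contDiff.differentiable (by simp)

theorem eq_zero (hφ : IsTestFunction Ω φ) {x : Eu d} (hx : x ∉ Ω) : φ x = 0 :=
  image_eq_zero_of_notMem_tsupport fun h => hx (hφ.tsupport_subset h)

theorem mul_contDiff (hφ : IsTestFunction Ω φ) {ψ : Eu d → ℝ} (hψ : ContDiff ℝ ∞ ψ) :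
    IsTestFunction Ω fun x => φ x * ψ x :=
  ⟨hφ.contDiff.mul hψ, hφ.hasCompactSupport.mul_right,
    tsupport_mul_subset_left.trans hφ.tsupport_subset⟩

theorem tsupport_pderiv_subset (φ : Eu d → ℝ) (i : Fin d) :
    tsupport (pderiv i φ) ⊆ tsupport φ := by
  have hsupp : Function.support (pderiv i φ) ⊆ Function.support (fderiv ℝ φ) := fun x hx h =>
    hx (by simp only [pderiv, h, zero_apply])
  exact (closure_mono hsupp).trans (tsupport_fderiv_subset ℝ)

theorem pderiv (hφ : IsTestFunction Ω φ) (i : Fin d) : IsTestFunction Ω (pderiv i φ) :=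
  ⟨(hφ.contDiff.fderiv_right (by simp)).clm_apply contDiff_const,
    hφ.hasCompactSupport.fderiv_apply (𝕜 := ℝ) _,
    (tsupport_pderiv_subset φ i).trans hφ.tsupport_subset⟩

theorem exists_norm_le (hφ : IsTestFunction Ω φ) : ∃ C, ∀ x, ‖φ x‖ ≤ C :=
  hφ.hasCompactSupport.exists_bound_of_continuous hφ.continuous

theorem integrable_smul (hφ : IsTestFunction Ω φ) {u : Eu d → F}
    (hu : LocallyIntegrableOn u Ω) : Integrable fun x => φ x • u x := by
  have hK : IsCompact (tsupport φ) := hφ.hasCompactSupport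
  have hint := (hu.integrableOn_compact_subset hφ.tsupport_subset hK).continuousOn_smul
    hφ.continuous.continuousOn hK
  exact (integrableOn_iff_integrable_of_support_subset
    ((Function.support_smul_subset_left φ u).trans (subset_tsupport φ))).1 hint

theorem integrable_smul_smul (hφ : IsTestFunction Ω φ) {ψ : Eu d → ℝ} (hψ : ContDiff ℝ ∞ ψ)
    {u : Eu d → F} (hu : LocallyIntegrableOn u Ω) : Integrable fun x => ψ x • φ x • u x := by
  simpa only [mul_comm (φ _), mul_smul] using (hφ.mul_contDiff hψ).integrable_smul hu

theorem setIntegral_smul (hφ : IsTestFunction Ω φ) (u : Eu d → F) :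
    ∫ x in Ω, φ x • u x = ∫ x, φ x • u x :=
  setIntegral_eq_integral_of_forall_compl_eq_zero fun x hx => by rw [hφ.eq_zero hx, zero_smul]

theorem ae_norm_smul_le (hφ : IsTestFunction Ω φ) {C M : ℝ} (hC : ∀ x, ‖φ x‖ ≤ C)
    {u : Eu d → F} (hM : ∀ᵐ x, x ∈ Ω → ‖u x‖ ≤ M) : ∀ᵐ x, ‖φ x • u x‖ ≤ C * |M| := by
  filter_upwards [hM] with x hx
  have hC0 : 0 ≤ C := (norm_nonneg _).trans (hC x)
  by_cases hxΩ : x ∈ Ω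
  · rw [norm_smul]
    exact mul_le_mul (hC x) ((hx hxΩ).trans (le_abs_self M)) (norm_nonneg _) hC0
  · rw [hφ.eq_zero hxΩ, zero_smul, norm_zero]
    exact mul_nonneg hC0 (abs_nonneg M)

end IsTestFunction

theorem exists_isTestFunction_one_nhdsSet (hΩ : IsOpen Ω) {K : Set (Eu d)} (hK : IsCompact K)
    (hKΩ : K ⊆ Ω) :
    ∃ χ, IsTestFunction Ω χ ∧ (∀ x, ‖χ x‖ ≤ 1) ∧ ∀ᶠ x in 𝓝ˢ K, χ x = 1 := by
  obtain ⟨L, hL, hKL, hLΩ⟩ := exists_compact_between hK hΩ hKΩ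
  obtain ⟨χ, hχK, hχL, hχ⟩ := exists_contMDiffMap_one_nhds_of_subset_interior
    (modelWithCornersSelf ℝ (Eu d)) (n := ⊤) hK.isClosed hKL
  have hsupp : tsupport χ ⊆ L :=
    closure_minimal (fun x hx => by_contra fun h => hx (hχL x h)) hL.isClosed
  refine ⟨χ, ⟨χ.contMDiff.contDiff, hL.of_isClosed_subset (isClosed_tsupport _) hsupp,
    hsupp.trans hLΩ⟩, fun x => ?_, hχK⟩
  rw [Real.norm_of_nonneg (hχ x).1]
  exact (hχ x).2

theorem pderiv_eq_zero_of_eventually_eq_one {χ : Eu d → ℝ} {K : Set (Eu d)}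
    (hχ : ∀ᶠ x in 𝓝ˢ K, χ x = 1) {x : Eu d} (hx : x ∈ K) (i : Fin d) : pderiv i χ x = 0 := by
  have hloc : χ =ᶠ[𝓝 x] fun _ => 1 := eventually_nhdsSet_iff_forall.1 hχ x hx
  simp only [pderiv, hloc.fderiv_eq, fderiv_fun_const, Pi.zero_apply, zero_apply]

end TestFunction

section WeakPartial

variable {d : ℕ} {Ω : Set (Eu d)} {i : Fin d} {F : Type*} [NormedAddCommGroup F] [NormedSpace ℝ F]

theorem isWeakPartial_iff {u g : Eu d → F} :
    IsWeakPartial Ω i u g ↔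
      ∀ φ, IsTestFunction Ω φ → ∫ x, pderiv i φ x • u x = -∫ x, φ x • g x := by
  have hiff : ∀ φ, IsTestFunction Ω φ →
      (∫ x in Ω, pderiv i φ x • u x = -∫ x in Ω, φ x • g x ↔
        ∫ x, pderiv i φ x • u x = -∫ x, φ x • g x) := fun φ hφ => by
    rw [(hφ.pderiv i).setIntegral_smul, hφ.setIntegral_smul]
  exact ⟨fun h φ hφ => (hiff φ hφ).1 (h φ hφ.contDiff hφ.hasCompactSupport hφ.tsupport_subset),
    fun h φ hs hc hΩ => (hiff φ ⟨hs, hc, hΩ⟩).2 (h φ ⟨hs, hc, hΩ⟩)⟩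

theorem integral_pderiv_smul_const {φ : Eu d → ℝ} (hφ : IsTestFunction Ω φ) (i : Fin d) (c : F) :
    ∫ x, pderiv i φ x • c = 0 := by
  have hint : ∀ {ψ : Eu d → ℝ}, IsTestFunction Ω ψ → Integrable fun x => ψ x • c := fun hψ =>
    hψ.integrable_smul ((locallyIntegrable_const c).locallyIntegrableOn Ω)
  have hparts := integral_smul_fderiv_eq_neg_fderiv_smul_of_integrable (μ := volume) (f := φ)
    (g := fun _ => c) (v := EuclideanSpace.single i 1) (hint (hφ.pderiv i)) (by simp) (hint hφ)
    (fun x _ => hφ.differentiable x) (fun x _ => differentiableAt_const c)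
  simpa [pderiv, eq_comm] using hparts

theorem tendsto_integral_mollify_smul_of_bounded {v : Eu d → ℝ} {w : Eu d → F} {M : ℝ}
    (hv : LocallyIntegrable v) (hM : ∀ᵐ x, ‖v x‖ ≤ M) (hw : Integrable w) :
    Tendsto (fun j => ∫ x, mollify j v x • w x) atTop (𝓝 (∫ x, v x • w x)) := by
  refine tendsto_integral_of_dominated_convergence (fun x => M * ‖w x‖)
    (fun j => (contDiff_mollify hv j).continuous.aestronglyMeasurable.smul hw.1)
    (hw.norm.const_mul M) (fun j => ae_of_all _ fun x => ?_) ?_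
  · rw [norm_smul]
    exact mul_le_mul_of_nonneg_right (norm_mollify_le hM j x) (norm_nonneg _)
  · filter_upwards [ae_tendsto_mollify hv] with x hx
    exact hx.smul_const _

namespace IsWeakPartial

theorem congr_ae {u u' g g' : Eu d → F} (h : IsWeakPartial Ω i u g)
    (hu : u =ᵐ[volume.restrict Ω] u') (hg : g =ᵐ[volume.restrict Ω] g') :
    IsWeakPartial Ω i u' g' := by
  intro φ hs hc hφ
  rw [← integral_congr_ae (hu.mono fun x hx => congrArg (fderiv ℝ φ x _ • ·) hx),
    ← integral_congr_ae (hg.mono fun x hx => congrArg (φ x • ·) hx)]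
  exact h φ hs hc hφ

theorem ae_unique [CompleteSpace F] {u g g' : Eu d → F} (hΩ : IsOpen Ω)
    (h : IsWeakPartial Ω i u g) (h' : IsWeakPartial Ω i u g') (hg : LocallyIntegrableOn g Ω)
    (hg' : LocallyIntegrableOn g' Ω) : g =ᵐ[volume.restrict Ω] g' := by
  have hzero := hΩ.ae_eq_zero_of_integral_contDiff_smul_eq_zero (hg.sub hg')
    fun φ hs hc hφΩ => by
      have hφ : IsTestFunction Ω φ := ⟨hs, hc, hφΩ⟩
      simp only [Pi.sub_apply, smul_sub]
      rw [integral_sub (hφ.integrable_smul hg) (hφ.integrable_smul hg'), sub_eq_zero,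
        ← neg_inj, ← isWeakPartial_iff.1 h φ hφ, ← isWeakPartial_iff.1 h' φ hφ]
  rw [EventuallyEq, ae_restrict_iff' hΩ.measurableSet]
  filter_upwards [hzero] with x hx hxΩ
  exact sub_eq_zero.1 (hx hxΩ)

theorem clm_add_const {E : Type*} [NormedAddCommGroup E] [NormedSpace ℝ E] [CompleteSpace E]
    [CompleteSpace F] {u g : Eu d → E} (h : IsWeakPartial Ω i u g) (hu : LocallyIntegrableOn u Ω)
    (hg : LocallyIntegrableOn g Ω) (L : E →L[ℝ] F) (c : F) :
    IsWeakPartial Ω i (fun x => L (u x) + c) fun x => L (g x) := by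
  refine isWeakPartial_iff.2 fun φ hφ => ?_
  have hu' := (hφ.pderiv i).integrable_smul hu
  calc ∫ x, pderiv i φ x • (L (u x) + c)
      = ∫ x, L (pderiv i φ x • u x) + pderiv i φ x • c := by simp only [smul_add, map_smul]
    _ = L (∫ x, pderiv i φ x • u x) := by
        rw [integral_add (L.integrable_comp hu') ((hφ.pderiv i).integrable_smul
          ((locallyIntegrable_const c).locallyIntegrableOn Ω)), integral_pderiv_smul_const hφ,
          add_zero, L.integral_comp_comm hu']
    _ = -∫ x, φ x • L (g x) := by
        rw [isWeakPartial_iff.1 h φ hφ, map_neg, ← L.integral_comp_comm (hφ.integrable_smul hg)]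
        simp only [map_smul]

theorem integral_smul_pderiv_smul {u g : Eu d → F} (h : IsWeakPartial Ω i u g)
    (hu : LocallyIntegrableOn u Ω) {φ : Eu d → ℝ} (hφ : IsTestFunction Ω φ) {ψ : Eu d → ℝ}
    (hψ : ContDiff ℝ ∞ ψ) :
    ∫ x, ψ x • pderiv i φ x • u x =
      -(∫ x, pderiv i ψ x • φ x • u x) - ∫ x, ψ x • φ x • g x := by
  have hpderiv : ∀ x, pderiv i (fun y => φ y * ψ y) x • u x =
      pderiv i ψ x • φ x • u x + ψ x • pderiv i φ x • u x := fun x => by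
    rw [pderiv_mul (hφ.differentiable x) (hψ.differentiable (by simp) x), add_smul, mul_comm,
      mul_smul, mul_smul]
  have hψi : ContDiff ℝ ∞ (pderiv i ψ) :=
    (hψ.fderiv_right (by simp)).clm_apply contDiff_const
  have hprod := isWeakPartial_iff.1 h _ (hφ.mul_contDiff hψ)
  simp only [hpderiv] at hprod
  rw [integral_add (hφ.integrable_smul_smul hψi hu)
    ((hφ.pderiv i).integrable_smul_smul hψ hu)] at hprod
  simp only [mul_comm (φ _), mul_smul] at hprod
  rw [eq_sub_of_add_eq' hprod]
  abel

theorem smul_of_isTestFunction {u g : Eu d → F} (h : IsWeakPartial Ω i u g)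
    (hu : LocallyIntegrableOn u Ω) (hg : LocallyIntegrableOn g Ω) {χ : Eu d → ℝ}
    (hχ : IsTestFunction Ω χ) :
    IsWeakPartial univ i (fun x => χ x • u x) fun x => pderiv i χ x • u x + χ x • g x := by
  refine isWeakPartial_iff.2 fun φ hφ => ?_
  simp only [smul_add]
  rw [integral_add ((hχ.pderiv i).integrable_smul_smul hφ.contDiff hu)
    (hχ.integrable_smul_smul hφ.contDiff hg), h.integral_smul_pderiv_smul hu hχ hφ.contDiff]
  abel

theorem pderiv_mollify {u g : Eu d → F} (h : IsWeakPartial univ i u g)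
    (hu : LocallyIntegrable u) (j : ℕ) (x : Eu d) :
    pderiv i (mollify j u) x = mollify j g x := by
  have hφ : IsTestFunction univ fun t => mollifier d j (x - t) :=
    ⟨(contDiff_mollifier j).comp (contDiff_const.sub contDiff_id),
      (hasCompactSupport_mollifier j).comp_homeomorph (Homeomorph.subLeft x), subset_univ _⟩
  have hpd : ∀ t, pderiv i (fun t => mollifier d j (x - t)) t =
      -pderiv i (mollifier d j) (x - t) := fun t => by
    have hη : DifferentiableAt ℝ (mollifier d j) (x - t) :=
      (contDiff_mollifier j).differentiable (by simp) _
    have hcomp : HasFDerivAt (fun t => mollifier d j (x - t)) _ t :=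
      hη.hasFDerivAt.comp t ((hasFDerivAt_id t).const_sub x)
    simp [pderiv, hcomp.fderiv]
  have hparts := isWeakPartial_iff.1 h _ hφ
  simp only [hpd, neg_smul, integral_neg, neg_inj] at hparts
  have hderiv := (hasCompactSupport_mollifier j).hasFDerivAt_convolution_right
    (ContinuousLinearMap.lsmul ℝ ℝ).flip hu ((contDiff_mollifier j).of_le (by simp)) x
  have hflip : mollify j u =
      convolution u (mollifier d j) (ContinuousLinearMap.lsmul ℝ ℝ).flip volume :=
    funext fun y => mollify_apply_sub j u y
  rw [mollify_apply_sub, ← hparts, pderiv, hflip, hderiv.fderiv, convolution_precompR_apply _ hu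
    ((hasCompactSupport_mollifier j).fderiv ℝ)
    ((contDiff_mollifier j).continuous_fderiv (by simp))]
  rfl

theorem smul_of_univ [CompleteSpace F] {v f : Eu d → ℝ} {u g : Eu d → F} {M N : ℝ}
    (hvf : IsWeakPartial univ i v f) (hug : IsWeakPartial Ω i u g) (hv : LocallyIntegrable v)
    (hf : Integrable f) (hu : LocallyIntegrableOn u Ω) (hg : LocallyIntegrableOn g Ω)
    (hM : ∀ᵐ x, ‖v x‖ ≤ M) (hN : ∀ᵐ x, x ∈ Ω → ‖u x‖ ≤ N) :
    IsWeakPartial Ω i (fun x => v x • u x) fun x => v x • g x + f x • u x := by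
  refine isWeakPartial_iff.2 fun φ hφ => ?_
  obtain ⟨C, hC⟩ := hφ.exists_norm_le
  have hpu := (hφ.pderiv i).integrable_smul hu
  have hφu := hφ.integrable_smul hu
  have hφg := hφ.integrable_smul hg
  have hφuC := hφ.ae_norm_smul_le hC hN
  have hmoll : ∀ j, ∫ x, mollify j v x • pderiv i φ x • u x =
      -(∫ x, mollify j f x • φ x • u x) - ∫ x, mollify j v x • φ x • g x := fun j => by
    simpa only [hvf.pderiv_mollify hv]
      using hug.integral_smul_pderiv_smul hu hφ (contDiff_mollify hv j)
  have hlim := ((tendsto_integral_mollify_smul hf hφu.1 hφuC).neg.sub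
    (tendsto_integral_mollify_smul_of_bounded hv hM hφg)).congr fun j => (hmoll j).symm
  have heq := tendsto_nhds_unique (tendsto_integral_mollify_smul_of_bounded hv hM hpu) hlim
  simp only [smul_add, smul_comm (φ _) (v _), smul_comm (φ _) (f _), smul_comm (pderiv i φ _)]
  have hvg : Integrable fun x => v x • φ x • g x := hφg.bdd_smul M hv.aestronglyMeasurable hM
  have hfu : Integrable fun x => f x • φ x • u x := hf.smul_bdd (C * |N|) hφu.1 hφuC
  rw [heq, integral_add hvg hfu]
  abel

theorem smul [CompleteSpace F] (hΩ : IsOpen Ω) {v f : Eu d → ℝ} {u g : Eu d → F} {M N : ℝ}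
    (hvf : IsWeakPartial Ω i v f) (hug : IsWeakPartial Ω i u g) (hv : LocallyIntegrableOn v Ω)
    (hf : LocallyIntegrableOn f Ω) (hu : LocallyIntegrableOn u Ω) (hg : LocallyIntegrableOn g Ω)
    (hM : ∀ᵐ x, x ∈ Ω → ‖v x‖ ≤ M) (hN : ∀ᵐ x, x ∈ Ω → ‖u x‖ ≤ N) :
    IsWeakPartial Ω i (fun x => v x • u x) fun x => v x • g x + f x • u x := by
  refine isWeakPartial_iff.2 fun φ hφ => ?_
  obtain ⟨χ, hχ, hχ1, hχφ⟩ :=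
    exists_isTestFunction_one_nhdsSet hΩ hφ.hasCompactSupport hφ.tsupport_subset
  have hcut := isWeakPartial_iff.1 ((hvf.smul_of_isTestFunction hv hf hχ).smul_of_univ hug
    (hχ.integrable_smul hv).locallyIntegrable
    (((hχ.pderiv i).integrable_smul hv).add (hχ.integrable_smul hf)) hu hg
    (hχ.ae_norm_smul_le hχ1 hM) hN) φ hφ
  have hcut_u : ∀ x, pderiv i φ x • v x • u x = pderiv i φ x • (χ x • v x) • u x := fun x => by
    by_cases hx : x ∈ tsupport φ
    · rw [hχφ.self_of_nhdsSet x hx, one_smul]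
    · have hφx : pderiv i φ x = 0 := image_eq_zero_of_notMem_tsupport fun h =>
        hx (IsTestFunction.tsupport_pderiv_subset φ i h)
      rw [hφx, zero_smul, zero_smul]
  have hcut_g : ∀ x, φ x • (v x • g x + f x • u x) =
      φ x • ((χ x • v x) • g x + (pderiv i χ x • v x + χ x • f x) • u x) := fun x => by
    by_cases hx : x ∈ tsupport φ
    · simp only [hχφ.self_of_nhdsSet x hx, pderiv_eq_zero_of_eventually_eq_one hχφ hx, one_smul,
        zero_smul, zero_add]
    · rw [image_eq_zero_of_notMem_tsupport hx, zero_smul, zero_smul]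
  simpa only [hcut_u, hcut_g] using hcut

end IsWeakPartial

end WeakPartial

section Translation

variable {d : ℕ} {F : Type*} [NormedAddCommGroup F] [NormedSpace ℝ F]

theorem enorm_fderiv_apply_le (u : Eu d → F) (x h : Eu d) :
    ‖fderiv ℝ u x h‖ₑ ≤ ‖h‖ₑ * ∑ i, ‖pderiv i u x‖ₑ := by
  have hh : fderiv ℝ u x h = ∑ i, h i • pderiv i u x := by
    conv_lhs => rw [← (EuclideanSpace.basisFun (Fin d) ℝ).sum_repr h]
    simp [pderiv]
  rw [hh, Finset.mul_sum]
  refine (enorm_sum_le _ _).trans (Finset.sum_le_sum fun i _ => ?_)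
  rw [enorm_smul]
  gcongr
  exact enorm_le_iff_norm_le.2 (PiLp.norm_apply_le h i)

theorem enorm_sub_le_lintegral_enorm_fderiv [CompleteSpace F] {u : Eu d → F}
    (hu : ContDiff ℝ ∞ u) (x h : Eu d) :
    ‖u (x + h) - u x‖ₑ ≤ ∫⁻ t in Ioc (0 : ℝ) 1, ‖fderiv ℝ u (x + t • h) h‖ₑ := by
  have hderiv : ∀ t ∈ uIcc (0 : ℝ) 1,
      HasDerivAt (fun t : ℝ => u (x + t • h)) (fderiv ℝ u (x + t • h) h) t := fun t _ => by
    have hline : HasDerivAt (fun t : ℝ => x + t • h) h t := by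
      simpa using ((hasDerivAt_id t).smul_const h).const_add x
    exact (hu.differentiable (by simp) _).hasFDerivAt.comp_hasDerivAt t hline
  have hcont : Continuous fun t : ℝ => fderiv ℝ u (x + t • h) h :=
    ((hu.continuous_fderiv (by simp)).comp (by fun_prop)).clm_apply continuous_const
  have hftc := intervalIntegral.integral_eq_sub_of_hasDerivAt hderiv
    (hcont.intervalIntegrable 0 1)
  simp only [one_smul, zero_smul, add_zero] at hftc
  rw [← hftc, intervalIntegral.integral_of_le zero_le_one]
  exact enorm_integral_le_lintegral_enorm _

theorem lintegral_enorm_translate_sub_le_of_contDiff [CompleteSpace F] {u : Eu d → F}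
    (hu : ContDiff ℝ ∞ u) (h : Eu d) :
    ∫⁻ x, ‖u (x + h) - u x‖ₑ ≤ ‖h‖ₑ * ∑ i, ∫⁻ x, ‖pderiv i u x‖ₑ := by
  have hcont : Continuous (fderiv ℝ u) := hu.continuous_fderiv (by simp)
  have hpderiv : ∀ i, Continuous (pderiv i u) := fun i => hcont.clm_apply continuous_const
  have hm : AEMeasurable (fun z : Eu d × ℝ => ‖fderiv ℝ u (z.1 + z.2 • h) h‖ₑ)
      (volume.prod (volume.restrict (Ioc (0 : ℝ) 1))) :=
    ((hcont.comp (by fun_prop)).clm_apply continuous_const).enorm.aemeasurable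
  calc ∫⁻ x, ‖u (x + h) - u x‖ₑ
      ≤ ∫⁻ x, ∫⁻ t in Ioc (0 : ℝ) 1, ‖fderiv ℝ u (x + t • h) h‖ₑ :=
        lintegral_mono fun x => enorm_sub_le_lintegral_enorm_fderiv hu x h
    _ = ∫⁻ t in Ioc (0 : ℝ) 1, ∫⁻ x, ‖fderiv ℝ u (x + t • h) h‖ₑ := lintegral_lintegral_swap hm
    _ = ∫⁻ x, ‖fderiv ℝ u x h‖ₑ := by
        simp only [lintegral_add_right_eq_self fun x => ‖fderiv ℝ u x h‖ₑ]
        simp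
    _ ≤ ∫⁻ x, ‖h‖ₑ * ∑ i, ‖pderiv i u x‖ₑ :=
        lintegral_mono fun x => enorm_fderiv_apply_le u x h
    _ = ‖h‖ₑ * ∑ i, ∫⁻ x, ‖pderiv i u x‖ₑ := by
        rw [lintegral_const_mul' _ _ enorm_ne_top,
          lintegral_finsetSum _ fun i _ => (hpderiv i).enorm.measurable]

theorem lintegral_enorm_translate_sub_le [CompleteSpace F] {u : Eu d → F} {g : Fin d → Eu d → F}
    (hw : ∀ i, IsWeakPartial univ i u (g i)) (hu : LocallyIntegrable u)
    (hg : ∀ i, AEStronglyMeasurable (g i)) (h : Eu d) :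
    ∫⁻ x, ‖u (x + h) - u x‖ₑ ≤ ‖h‖ₑ * ∑ i, ∫⁻ x, ‖g i x‖ₑ := by
  have hlim : ∀ᵐ x, Tendsto (fun j => ‖mollify j u (x + h) - mollify j u x‖ₑ) atTop
      (𝓝 ‖u (x + h) - u x‖ₑ) := by
    have hae := ae_tendsto_mollify hu
    filter_upwards [hae, (measurePreserving_add_right volume h).quasiMeasurePreserving.ae hae]
      with x hx hxh
    exact (hxh.sub hx).enorm
  have hsmooth : ∀ j, ∫⁻ x, ‖mollify j u (x + h) - mollify j u x‖ₑ ≤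
      ‖h‖ₑ * ∑ i, ∫⁻ x, ‖g i x‖ₑ := fun j => by
    refine (lintegral_enorm_translate_sub_le_of_contDiff (contDiff_mollify hu j) h).trans ?_
    simp only [(hw _).pderiv_mollify hu]
    gcongr ‖h‖ₑ * ∑ i, ?_ with i
    exact lintegral_enorm_mollify_le (hg i) j
  have hmeas : ∀ j, Measurable fun x => ‖mollify j u (x + h) - mollify j u x‖ₑ := fun j => by
    have hc := (contDiff_mollify hu j).continuous
    exact ((hc.comp (continuous_add_const h)).sub hc).enorm.measurable
  calc ∫⁻ x, ‖u (x + h) - u x‖ₑ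
      = ∫⁻ x, liminf (fun j => ‖mollify j u (x + h) - mollify j u x‖ₑ) atTop :=
        lintegral_congr_ae (hlim.mono fun x hx => hx.liminf_eq.symm)
    _ ≤ liminf (fun j => ∫⁻ x, ‖mollify j u (x + h) - mollify j u x‖ₑ) atTop :=
        lintegral_liminf_le hmeas
    _ ≤ _ := liminf_le_of_frequently_le' (Frequently.of_forall hsmooth)

theorem lintegral_enorm_mollify_sub_le [CompleteSpace F] {u : Eu d → F} {g : Fin d → Eu d → F}
    (hw : ∀ i, IsWeakPartial univ i u (g i)) (hu : LocallyIntegrable u)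
    (hg : ∀ i, AEStronglyMeasurable (g i)) (j : ℕ) :
    ∫⁻ x, ‖mollify j u x - u x‖ₑ ≤
      ENNReal.ofReal (1 / (j + 1)) * ∑ i, ∫⁻ x, ‖g i x‖ₑ := by
  set S := ∑ i, ∫⁻ x, ‖g i x‖ₑ
  have hsub : ∀ x, mollify j u x - u x = ∫ t, mollifier d j t • (u (x - t) - u x) := fun x => by
    simp only [smul_sub]
    rw [integral_sub (integrable_mollifier_smul_sub hu j x)
      ((integrable_mollifier j).smul_const (u x)), integral_smul_const, integral_mollifier,
      one_smul, mollify_apply]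
  have hm : AEMeasurable (fun z : Eu d × Eu d => ‖mollifier d j z.2 • (u (z.1 - z.2) - u z.1)‖ₑ)
      (volume.prod volume) := by
    have hconv := (integrable_mollifier (d := d) j).1.convolution_integrand
      (ContinuousLinearMap.lsmul ℝ ℝ) hu.aestronglyMeasurable
    have hprod := (integrable_mollifier (d := d) j).1.comp_snd (α := Eu d) (μ := volume)
      |>.smul hu.aestronglyMeasurable.comp_fst
    simp only [smul_sub]
    exact (hconv.sub hprod).enorm
  calc ∫⁻ x, ‖mollify j u x - u x‖ₑ
      ≤ ∫⁻ x, ∫⁻ t, ‖mollifier d j t • (u (x - t) - u x)‖ₑ :=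
        lintegral_mono fun x => hsub x ▸ enorm_integral_le_lintegral_enorm _
    _ = ∫⁻ t, ∫⁻ x, ‖mollifier d j t • (u (x - t) - u x)‖ₑ := lintegral_lintegral_swap hm
    _ ≤ ∫⁻ t, ‖mollifier d j t‖ₑ * (ENNReal.ofReal (1 / (j + 1)) * S) := by
        refine lintegral_mono fun t => ?_
        simp only [enorm_smul]
        rw [lintegral_const_mul' _ _ enorm_ne_top]
        by_cases ht : 1 / ((j : ℝ) + 1) < ‖t‖
        · simp [mollifier_eq_zero ht]
        · have htrans := lintegral_enorm_translate_sub_le hw hu hg (-t)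
          simp only [← sub_eq_add_neg, enorm_neg] at htrans
          gcongr
          refine htrans.trans ?_
          gcongr
          rw [← ofReal_norm]
          exact ENNReal.ofReal_le_ofReal (not_lt.1 ht)
    _ = ENNReal.ofReal (1 / (j + 1)) * S := by
        rw [lintegral_mul_const _ (continuous_mollifier j).enorm.measurable,
          lintegral_enorm_mollifier, one_mul]

end Translation

section Compactness

theorem exists_subseq_forall_tendsto_apply {E : Type*} [SeminormedAddCommGroup E]
    [NormedSpace ℝ E] [TopologicalSpace.SeparableSpace E] {T : ℕ → StrongDual ℝ E} {C : ℝ}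
    (hT : ∀ k, ‖T k‖ ≤ C) :
    ∃ ns : ℕ → ℕ, StrictMono ns ∧
      ∃ T' : StrongDual ℝ E, ∀ x, Tendsto (fun k => T (ns k) x) atTop (𝓝 (T' x)) := by
  obtain ⟨T', -, ns, hns, hlim⟩ := WeakDual.isSeqCompact_closedBall ℝ E 0 C
    (x := fun k => StrongDual.toWeakDual (T k)) fun k => mem_closedBall_zero_iff.2 (hT k)
  exact ⟨ns, hns, WeakDual.toStrongDual T', fun x =>
    ((WeakDual.eval_continuous x).tendsto T').comp hlim⟩

theorem exists_subseq_forall_exists_tendsto_integral_smul {α F : Type*} {m : MeasurableSpace α}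
    {μ : Measure α} [IsSeparable μ] [NormedAddCommGroup F] [InnerProductSpace ℝ F]
    [FiniteDimensional ℝ F] {u : ℕ → α → F} {M : ℝ} (hu : ∀ k, AEStronglyMeasurable (u k) μ)
    (hM : ∀ k, ∀ᵐ x ∂μ, ‖u k x‖ ≤ M) :
    ∃ ns : ℕ → ℕ, StrictMono ns ∧ ∀ h : α → ℝ, Integrable h μ →
      ∃ c : F, Tendsto (fun k => ∫ x, h x • u (ns k) x ∂μ) atTop (𝓝 c) := by
  have : Fact ((1 : ℝ≥0∞) ≠ ⊤) := ⟨ENNReal.one_ne_top⟩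
  have : ProperSpace F := FiniteDimensional.proper_real F
  have hmem : ∀ k, MemLp (u k) ∞ μ := fun k => memLp_top_of_bound (hu k) M (hM k)
  let T : ℕ → StrongDual ℝ (Lp F 1 μ) := fun k =>
    (innerSL ℝ).lpPairing μ ∞ 1 ((hmem k).toLp (u k))
  have hTapply : ∀ k (H : Lp F 1 μ), T k H = ∫ x, inner ℝ (u k x) (H x) ∂μ := fun k H => by
    refine (ContinuousLinearMap.lpPairing_eq_integral _ _ _).trans (integral_congr_ae ?_)
    filter_upwards [(hmem k).coeFn_toLp] with x hx
    rw [hx, innerSL_apply_apply]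
  have hT : ∀ k, ‖T k‖ ≤ |M| := fun k => by
    refine ContinuousLinearMap.opNorm_le_bound _ (abs_nonneg M) fun H => ?_
    rw [hTapply, L1.norm_eq_integral_norm, ← integral_const_mul]
    refine norm_integral_le_of_norm_le ((L1.integrable_coeFn H).norm.const_mul _) ?_
    filter_upwards [hM k] with x hx
    exact (norm_inner_le_norm _ _).trans (by gcongr; exact hx.trans (le_abs_self M))
  obtain ⟨ns, hns, T', hlim⟩ := exists_subseq_forall_tendsto_apply hT
  refine ⟨ns, hns, fun h hh => ?_⟩
  let b := stdOrthonormalBasis ℝ F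
  let H : Fin (Module.finrank ℝ F) → Lp F 1 μ := fun a =>
    (memLp_one_iff_integrable.2 (hh.smul_const (b a))).toLp fun x => h x • b a
  have hH : ∀ k a, T k (H a) = inner ℝ (b a) (∫ x, h x • u k x ∂μ) := fun k a => by
    have hint : Integrable (fun x => h x • u k x) μ := hh.smul_of_top_left (hmem k)
    rw [hTapply, ← integral_inner hint]
    refine integral_congr_ae ?_
    filter_upwards [(memLp_one_iff_integrable.2 (hh.smul_const (b a))).coeFn_toLp] with x hx
    rw [hx, real_inner_smul_right, real_inner_smul_right, real_inner_comm]
  refine ⟨∑ a, T' (H a) • b a, ?_⟩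
  have hsum : ∀ k, ∫ x, h x • u (ns k) x ∂μ = ∑ a, T (ns k) (H a) • b a := fun k => by
    simp only [hH, b.sum_repr']
  simp only [hsum]
  exact tendsto_finsetSum _ fun a _ => (hlim (H a)).smul_const (b a)

theorem exists_subseq_ae_exists_tendsto {α E : Type*} {m : MeasurableSpace α} {μ : Measure α}
    [NormedAddCommGroup E] [CompleteSpace E] {u : ℕ → α → E} {K : ℕ → Set α} (hK : Monotone K)
    (hu : ∀ k n, AEStronglyMeasurable (u k) (μ.restrict (K n)))
    (hcau : ∀ n, Tendsto (fun kl : ℕ × ℕ => ∫⁻ x in K n, ‖u kl.1 x - u kl.2 x‖ₑ ∂μ) atTop (𝓝 0)) :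
    ∃ ns : ℕ → ℕ, StrictMono ns ∧
      ∀ᵐ x ∂μ.restrict (⋃ n, K n), ∃ l, Tendsto (fun k => u (ns k) x) atTop (𝓝 l) := by
  have hsmall : ∀ n, ∃ N, ∀ N' ≥ N, ∀ k ≥ N', ∀ l ≥ N',
      ∫⁻ x in K n, ‖u k x - u l x‖ₑ ∂μ < 2⁻¹ ^ n := fun n => by
    obtain ⟨⟨N₁, N₂⟩, hN⟩ := eventually_atTop.1
      ((hcau n).eventually_lt_const (ENNReal.pow_pos (by simp) n : (0 : ℝ≥0∞) < 2⁻¹ ^ n))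
    exact ⟨max N₁ N₂, fun N' hN' k hk l hl => hN (k, l)
      ⟨(le_max_left _ _).trans (hN'.trans hk), (le_max_right _ _).trans (hN'.trans hl)⟩⟩
  obtain ⟨ns, hns, hfast⟩ := extraction_forall_of_eventually' hsmall
  refine ⟨ns, hns, (ae_restrict_iUnion_iff _ _).2 fun n => ?_⟩
  have hshift : ∀ᵐ x ∂μ.restrict (K n), ∃ l, Tendsto (fun k => u (ns (k + n)) x) atTop (𝓝 l) := by
    refine Lp.ae_tendsto_of_cauchy_eLpNorm (p := 1) (B := fun N => 2⁻¹ ^ N)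
      (fun k => hu (ns (k + n)) n) le_rfl ?_ fun N k l hk hl => ?_
    · simp
    · rw [eLpNorm_one_eq_lintegral_enorm]
      refine (lintegral_mono_set (hK (Nat.le_add_right n N))).trans_lt
        ((hfast (n + N) _ (hns.monotone ?_) _ (hns.monotone ?_)).trans_le ?_)
      · lia
      · lia
      · exact pow_le_pow_right_of_le_one' (by simp) (Nat.le_add_left N n)
  exact hshift.mono fun x ⟨l, hl⟩ =>
    ⟨l, (tendsto_add_atTop_iff_nat (f := fun k => u (ns k) x) n).1 hl⟩

end Compactness

section Rellich

variable {d : ℕ} {Ω : Set (Eu d)} {F : Type*} [NormedAddCommGroup F]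

theorem exists_monotone_isCompact_iUnion_eq (hΩ : IsOpen Ω) :
    ∃ K : ℕ → Set (Eu d), Monotone K ∧ (∀ n, IsCompact (K n)) ∧ ⋃ n, K n = Ω := by
  obtain ⟨A, hA, -, hAΩ, hmono⟩ := hΩ.exists_iUnion_isClosed
  have hball : Monotone fun n : ℕ => Metric.closedBall (0 : Eu d) (n : ℝ) := fun m n hmn =>
    Metric.closedBall_subset_closedBall (Nat.cast_le.2 hmn)
  refine ⟨fun n => A n ∩ Metric.closedBall 0 n, hmono.inter hball,
    fun n => (isCompact_closedBall 0 (n : ℝ)).inter_left (hA n), ?_⟩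
  rw [iUnion_inter_of_monotone hmono hball, hAΩ, Metric.iUnion_closedBall_nat, inter_univ]

theorem ae_restrict_of_forall_isCompact (hΩ : IsOpen Ω) {P : Eu d → Prop}
    (hP : ∀ K ⊆ Ω, IsCompact K → ∀ᵐ x ∂volume.restrict K, P x) :
    ∀ᵐ x ∂volume.restrict Ω, P x := by
  obtain ⟨K, -, hK, hKΩ⟩ := exists_monotone_isCompact_iUnion_eq hΩ
  rw [← hKΩ, ae_restrict_iUnion_iff]
  exact fun n => hP _ (hKΩ ▸ subset_iUnion K n) (hK n)

variable [NormedSpace ℝ F]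

theorem mollify_eq_zero {u : Eu d → F} {K : Set (Eu d)} (hK : ∀ x ∉ K, u x = 0) {j : ℕ} {x : Eu d}
    (hx : x ∉ Metric.cthickening 1 K) : mollify j u x = 0 := by
  rw [mollify_apply_sub]
  refine integral_eq_zero_of_ae (ae_of_all _ fun t => ?_)
  by_cases ht : t ∈ K
  · have hdist : 1 < ‖x - t‖ := by
      rw [← dist_eq_norm]
      exact lt_of_not_ge fun h => hx (Metric.mem_cthickening_of_dist_le x t 1 K ht h)
    have hj : 1 / ((j : ℝ) + 1) ≤ 1 := (div_le_one (by positivity)).2 (by simp)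
    simp only [mollifier_eq_zero (hj.trans_lt hdist), zero_smul, Pi.zero_apply]
  · simp only [hK t ht, smul_zero, Pi.zero_apply]

theorem tendsto_lintegral_enorm_mollify_sub_mollify {v : ℕ → Eu d → F} {C : ℝ} {K : Set (Eu d)}
    (hv : ∀ k, AEStronglyMeasurable (v k)) (hC : ∀ k, ∀ᵐ x, ‖v k x‖ ≤ C) (hK : IsCompact K)
    (hvK : ∀ k, ∀ x ∉ K, v k x = 0)
    (hweak : ∀ h : Eu d → ℝ, Integrable h →
      ∃ c : F, Tendsto (fun k => ∫ x, h x • v k x) atTop (𝓝 c))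
    (j : ℕ) :
    Tendsto (fun kl : ℕ × ℕ => ∫⁻ x, ‖mollify j (v kl.1) x - mollify j (v kl.2) x‖ₑ) atTop
      (𝓝 0) := by
  have hlim : ∀ x, Tendsto (fun kl : ℕ × ℕ => ‖mollify j (v kl.1) x - mollify j (v kl.2) x‖ₑ)
      atTop (𝓝 0) := fun x => by
    obtain ⟨c, hc⟩ := hweak _ ((integrable_mollifier j).comp_sub_left x)
    simp only [← mollify_apply_sub] at hc
    rw [← prod_atTop_atTop_eq]
    simpa using ((hc.comp tendsto_fst).sub (hc.comp tendsto_snd)).enorm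
  have hmeas : ∀ k, Continuous (mollify j (v k)) := fun k =>
    (contDiff_mollify ((memLp_top_of_bound (hv k) C (hC k)).locallyIntegrable le_top) j).continuous
  have hbound : ∀ kl : ℕ × ℕ, ∀ x, ‖mollify j (v kl.1) x - mollify j (v kl.2) x‖ₑ ≤
      (Metric.cthickening 1 K).indicator (fun _ => ENNReal.ofReal (C + C)) x := fun kl x => by
    by_cases hx : x ∈ Metric.cthickening 1 K
    · rw [indicator_of_mem hx, ← ofReal_norm]
      exact ENNReal.ofReal_le_ofReal ((norm_sub_le _ _).trans
        (add_le_add (norm_mollify_le (hC _) j x) (norm_mollify_le (hC _) j x)))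
    · simp [mollify_eq_zero (hvK _) hx]
  rw [← lintegral_zero (μ := (volume : Measure (Eu d)))]
  refine tendsto_lintegral_filter_of_dominated_convergence _
    (Eventually.of_forall fun kl => ((hmeas _).sub (hmeas _)).enorm.measurable)
    (Eventually.of_forall fun kl => ae_of_all _ (hbound kl)) ?_ (ae_of_all _ hlim)
  rw [lintegral_indicator Metric.isClosed_cthickening.measurableSet, setLIntegral_const]
  exact ENNReal.mul_ne_top ENNReal.ofReal_ne_top hK.cthickening.measure_lt_top.ne

theorem lintegral_enorm_sub_le_mollify {u v : Eu d → F} (hu : LocallyIntegrable u)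
    (hv : LocallyIntegrable v) (j : ℕ) :
    ∫⁻ x, ‖u x - v x‖ₑ ≤ (∫⁻ x, ‖mollify j u x - u x‖ₑ) +
      (∫⁻ x, ‖mollify j u x - mollify j v x‖ₑ) + ∫⁻ x, ‖mollify j v x - v x‖ₑ := by
  have hm : ∀ {w : Eu d → F}, LocallyIntegrable w → AEMeasurable fun x => ‖mollify j w x - w x‖ₑ :=
    fun hw => ((contDiff_mollify hw j).continuous.aestronglyMeasurable.sub
      hw.aestronglyMeasurable).enorm
  rw [← lintegral_add_left' (hm hu), ← lintegral_add_right' _ (hm hv)]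
  refine lintegral_mono fun x => ?_
  simp only [← edist_eq_enorm_sub]
  rw [edist_comm (mollify j u x) (u x)]
  exact edist_triangle4 _ _ _ _

theorem tendsto_lintegral_enorm_sub_of_isWeakPartial [CompleteSpace F] {v : ℕ → Eu d → F}
    {g : ℕ → Fin d → Eu d → F} {C : ℝ} {K : Set (Eu d)} {S : ℝ≥0∞}
    (hv : ∀ k, AEStronglyMeasurable (v k)) (hg : ∀ k i, AEStronglyMeasurable (g k i))
    (hw : ∀ k i, IsWeakPartial univ i (v k) (g k i)) (hC : ∀ k, ∀ᵐ x, ‖v k x‖ ≤ C)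
    (hK : IsCompact K) (hvK : ∀ k, ∀ x ∉ K, v k x = 0)
    (hS : ∀ k, ∑ i, ∫⁻ x, ‖g k i x‖ₑ ≤ S) (hS_top : S ≠ ⊤)
    (hweak : ∀ h : Eu d → ℝ, Integrable h →
      ∃ c : F, Tendsto (fun k => ∫ x, h x • v k x) atTop (𝓝 c)) :
    Tendsto (fun kl : ℕ × ℕ => ∫⁻ x, ‖v kl.1 x - v kl.2 x‖ₑ) atTop (𝓝 0) := by
  have hv_loc : ∀ k, LocallyIntegrable (v k) := fun k =>
    (memLp_top_of_bound (hv k) C (hC k)).locallyIntegrable le_top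
  have hmoll : ∀ j k, ∫⁻ x, ‖mollify j (v k) x - v k x‖ₑ ≤ ENNReal.ofReal (1 / (j + 1)) * S :=
    fun j k => (lintegral_enorm_mollify_sub_le (hw k) (hv_loc k) (hg k) j).trans
      (by gcongr; exact hS k)
  have hδ : Tendsto (fun j : ℕ => ENNReal.ofReal (1 / (j + 1)) * S) atTop (𝓝 0) := by
    simpa using ENNReal.Tendsto.mul_const
      (ENNReal.tendsto_ofReal (tendsto_one_div_add_atTop_nhds_zero_nat (𝕜 := ℝ)))
      (Or.inr hS_top)
  refine ENNReal.tendsto_nhds_zero.2 fun ε hε => ?_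
  have hε3 : 0 < ε / 3 := ENNReal.div_pos hε.ne' (by simp)
  obtain ⟨j, hj⟩ := (hδ.eventually_le_const hε3).exists
  filter_upwards [(tendsto_lintegral_enorm_mollify_sub_mollify hv hC hK hvK hweak
    j).eventually_le_const hε3] with kl hkl
  calc ∫⁻ x, ‖v kl.1 x - v kl.2 x‖ₑ ≤ ε / 3 + ε / 3 + ε / 3 :=
        (lintegral_enorm_sub_le_mollify (hv_loc _) (hv_loc _) j).trans
          (add_le_add (add_le_add ((hmoll j _).trans hj) hkl) ((hmoll j _).trans hj))
    _ = ε := ENNReal.add_thirds ε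

theorem IsTestFunction.lintegral_enorm_smul_le {φ : Eu d → ℝ} (hφ : IsTestFunction Ω φ) {C : ℝ}
    (hC : ∀ x, ‖φ x‖ ≤ C) {u : Eu d → F} (hu : LocallyIntegrableOn u Ω) :
    ∫⁻ x, ‖φ x • u x‖ₑ ≤ ENNReal.ofReal (C * ∫ x in tsupport φ, ‖u x‖) := by
  have hint := hφ.integrable_smul hu
  have hsupp : ∫ x, ‖φ x • u x‖ = ∫ x in tsupport φ, ‖φ x • u x‖ :=
    (setIntegral_eq_integral_of_forall_compl_eq_zero fun x hx => by
      rw [image_eq_zero_of_notMem_tsupport hx, zero_smul, norm_zero]).symm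
  rw [← ofReal_integral_norm_eq_lintegral_enorm hint, hsupp, ← integral_const_mul]
  have hu_supp : IntegrableOn u (tsupport φ) :=
    hu.integrableOn_compact_subset hφ.tsupport_subset hφ.hasCompactSupport
  refine ENNReal.ofReal_le_ofReal
    (integral_mono hint.integrableOn.norm (hu_supp.norm.const_mul C) fun x => ?_)
  simp only [norm_smul]
  gcongr
  exact hC x

theorem exists_sum_lintegral_enorm_cutoff_le {χ : Eu d → ℝ} (hχ : IsTestFunction Ω χ)
    {u : ℕ → Eu d → F} {g : ℕ → Fin d → Eu d → F} {M : ℝ}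
    (hu : ∀ k, LocallyIntegrableOn (u k) Ω) (hM : ∀ k, ∀ᵐ x, x ∈ Ω → ‖u k x‖ ≤ M)
    (hg : ∀ k i, LocallyIntegrableOn (g k i) Ω)
    (hgC : ∀ K ⊆ Ω, IsCompact K → ∀ i, ∃ C, ∀ k, ∫ x in K, ‖g k i x‖ ≤ C) :
    ∃ S : ℝ≥0∞, S ≠ ⊤ ∧ ∀ k, ∑ i, ∫⁻ x, ‖pderiv i χ x • u k x + χ x • g k i x‖ₑ ≤ S := by
  obtain ⟨A, hA⟩ := hχ.exists_norm_le
  choose B hB using fun i => (hχ.pderiv i).exists_norm_le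
  choose C hC using hgC _ hχ.tsupport_subset hχ.hasCompactSupport
  have huM : ∀ k i, ∫ x in tsupport (pderiv i χ), ‖u k x‖ ≤
      M * volume.real (tsupport (pderiv i χ)) := fun k i => by
    refine (Real.le_norm_self _).trans
      (norm_setIntegral_le_of_norm_le_const_ae' (hχ.pderiv i).hasCompactSupport.measure_lt_top ?_)
    filter_upwards [hM k] with x hx hxs
    rw [norm_norm]
    exact hx ((hχ.pderiv i).tsupport_subset hxs)
  refine ⟨∑ i, (ENNReal.ofReal (B i * (M * volume.real (tsupport (pderiv i χ)))) +
    ENNReal.ofReal (A * C i)), by simp [ENNReal.sum_eq_top], fun k => ?_⟩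
  refine Finset.sum_le_sum fun i _ => ?_
  have hA0 : 0 ≤ A := (norm_nonneg _).trans (hA 0)
  have hB0 : 0 ≤ B i := (norm_nonneg _).trans (hB i 0)
  calc ∫⁻ x, ‖pderiv i χ x • u k x + χ x • g k i x‖ₑ
      ≤ ∫⁻ x, (‖pderiv i χ x • u k x‖ₑ + ‖χ x • g k i x‖ₑ) :=
        lintegral_mono fun x => enorm_add_le _ _
    _ = (∫⁻ x, ‖pderiv i χ x • u k x‖ₑ) + ∫⁻ x, ‖χ x • g k i x‖ₑ :=
        lintegral_add_left' ((hχ.pderiv i).integrable_smul (hu k)).1.enorm _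
    _ ≤ _ := by
        refine add_le_add (((hχ.pderiv i).lintegral_enorm_smul_le (hB i) (hu k)).trans ?_)
          ((hχ.lintegral_enorm_smul_le hA (hg k i)).trans ?_)
        · gcongr
          exact huM k i
        · gcongr
          exact hC i k

theorem tendsto_setLIntegral_enorm_sub_of_isWeakPartial [CompleteSpace F] (hΩ : IsOpen Ω)
    {u : ℕ → Eu d → F} {g : ℕ → Fin d → Eu d → F} {M : ℝ}
    (hu : ∀ k, LocallyIntegrableOn (u k) Ω) (hM : ∀ k, ∀ᵐ x, x ∈ Ω → ‖u k x‖ ≤ M)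
    (hg : ∀ k i, LocallyIntegrableOn (g k i) Ω) (hw : ∀ k i, IsWeakPartial Ω i (u k) (g k i))
    (hgC : ∀ K ⊆ Ω, IsCompact K → ∀ i, ∃ C, ∀ k, ∫ x in K, ‖g k i x‖ ≤ C)
    (hweak : ∀ h : Eu d → ℝ, IntegrableOn h Ω →
      ∃ c : F, Tendsto (fun k => ∫ x in Ω, h x • u k x) atTop (𝓝 c))
    {K : Set (Eu d)} (hK : IsCompact K) (hKΩ : K ⊆ Ω) :
    Tendsto (fun kl : ℕ × ℕ => ∫⁻ x in K, ‖u kl.1 x - u kl.2 x‖ₑ) atTop (𝓝 0) := by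
  obtain ⟨χ, hχ, hχ1, hχK⟩ := exists_isTestFunction_one_nhdsSet hΩ hK hKΩ
  obtain ⟨S, hS_top, hS⟩ := exists_sum_lintegral_enorm_cutoff_le hχ hu hM hg hgC
  have hweak_cut : ∀ h : Eu d → ℝ, Integrable h →
      ∃ c : F, Tendsto (fun k => ∫ x, h x • χ x • u k x) atTop (𝓝 c) := fun h hh => by
    have hhχ : Integrable fun x => h x * χ x :=
      hh.mul_bdd hχ.continuous.aestronglyMeasurable (ae_of_all _ hχ1)
    obtain ⟨c, hc⟩ := hweak _ hhχ.integrableOn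
    refine ⟨c, hc.congr fun k => ?_⟩
    simp only [mul_smul]
    exact setIntegral_eq_integral_of_forall_compl_eq_zero fun x hx => by
      rw [hχ.eq_zero hx, zero_smul, smul_zero]
  have hcut := tendsto_lintegral_enorm_sub_of_isWeakPartial
    (fun k => (hχ.integrable_smul (hu k)).1)
    (fun k i => (((hχ.pderiv i).integrable_smul (hu k)).add (hχ.integrable_smul (hg k i))).1)
    (fun k i => (hw k i).smul_of_isTestFunction (hu k) (hg k i) hχ)
    (fun k => hχ.ae_norm_smul_le hχ1 (hM k)) hχ.hasCompactSupport
    (fun k x hx => by rw [image_eq_zero_of_notMem_tsupport hx, zero_smul]) hS hS_top hweak_cut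
  refine tendsto_of_tendsto_of_tendsto_of_le_of_le tendsto_const_nhds hcut
    (fun _ => zero_le) fun kl => ?_
  calc ∫⁻ x in K, ‖u kl.1 x - u kl.2 x‖ₑ
      = ∫⁻ x in K, ‖χ x • u kl.1 x - χ x • u kl.2 x‖ₑ :=
        setLIntegral_congr_fun hK.measurableSet fun x hx => by
          simp only [hχK.self_of_nhdsSet x hx, one_smul]
    _ ≤ _ := setLIntegral_le_lintegral _ _

theorem exists_subseq_ae_tendsto_of_isWeakPartial {F : Type*} [NormedAddCommGroup F]
    [InnerProductSpace ℝ F] [FiniteDimensional ℝ F] (hΩ : IsOpen Ω)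
    {u : ℕ → Eu d → F} {g : ℕ → Fin d → Eu d → F} {M : ℝ}
    (hu : ∀ k, AEStronglyMeasurable (u k) (volume.restrict Ω))
    (hM : ∀ k, ∀ᵐ x ∂volume.restrict Ω, ‖u k x‖ ≤ M)
    (hg : ∀ k i, LocallyIntegrableOn (g k i) Ω) (hw : ∀ k i, IsWeakPartial Ω i (u k) (g k i))
    (hgC : ∀ K ⊆ Ω, IsCompact K → ∀ i, ∃ C, ∀ k, ∫ x in K, ‖g k i x‖ ≤ C) :
    ∃ ns : ℕ → ℕ, StrictMono ns ∧ ∃ u' : Eu d → F, StronglyMeasurable u' ∧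
      ∀ᵐ x ∂volume.restrict Ω, Tendsto (fun k => u (ns k) x) atTop (𝓝 (u' x)) := by
  obtain ⟨ns, hns, hweak⟩ := exists_subseq_forall_exists_tendsto_integral_smul hu hM
  obtain ⟨K, hKmono, hK, hKΩ⟩ := exists_monotone_isCompact_iUnion_eq hΩ
  have hKsub : ∀ n, K n ⊆ Ω := fun n => hKΩ ▸ subset_iUnion K n
  have hu_loc : ∀ k, LocallyIntegrableOn (u k) Ω := fun k =>
    locallyIntegrableOn_of_locallyIntegrable_restrict
      ((memLp_top_of_bound (hu k) M (hM k)).locallyIntegrable le_top)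
  obtain ⟨ms, hms, hae⟩ := exists_subseq_ae_exists_tendsto (u := fun k => u (ns k)) hKmono
    (fun k n => (hu (ns k)).mono_measure (Measure.restrict_mono_set _ (hKsub n)))
    fun n => tendsto_setLIntegral_enorm_sub_of_isWeakPartial hΩ (fun k => hu_loc (ns k))
      (fun k => ae_imp_of_ae_restrict (hM (ns k))) (fun k => hg (ns k)) (fun k => hw (ns k))
      (fun L hL hLc i => (hgC L hL hLc i).imp fun C hC k => hC (ns k)) hweak (hK n) (hKsub n)
  rw [hKΩ] at hae
  exact ⟨fun k => ns (ms k), hns.comp hms,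
    exists_stronglyMeasurable_limit_of_tendsto_ae (fun k => hu (ns (ms k))) hae⟩

end Rellich

section MatrixAlgebra

/-- The product `q n` of a matrix and a vector. -/
def applyMat (q : Mat9) (n : Eu 3) : Eu 3 := WithLp.toLp 2 ((asMatrix q).mulVec n)

/-- The rank-one matrix `e ⊗ n`. -/
def tensor (e n : Eu 3) : Mat9 := WithLp.toLp 2 fun ab => e ab.1 * n ab.2

/-- A `3 × 3` matrix as a point of `ℝ⁹`; the inverse of `asMatrix`. -/
def ofMatrix (A : Matrix (Fin 3) (Fin 3) ℝ) : Mat9 := WithLp.toLp 2 fun ab => A ab.1 ab.2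

theorem asMatrix_injective : Function.Injective asMatrix := fun _ _ h =>
  PiLp.ext fun ab => congrFun₂ h ab.1 ab.2

theorem applyMat_apply (q : Mat9) (n : Eu 3) (a : Fin 3) : applyMat q n a = ∑ b, q (a, b) * n b :=
  rfl

theorem inner_applyMat (e n : Eu 3) (q : Mat9) :
    inner ℝ e (applyMat q n) = inner ℝ (tensor e n) q := by
  simp only [PiLp.inner_apply, applyMat_apply, tensor, Fintype.sum_prod_type, RCLike.inner_apply,
    conj_trivial, Finset.sum_mul]
  exact Finset.sum_congr rfl fun a _ => Finset.sum_congr rfl fun b _ => by ring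

theorem norm_tensor (e n : Eu 3) : ‖tensor e n‖ = ‖e‖ * ‖n‖ := by
  rw [← sq_eq_sq₀ (norm_nonneg _) (by positivity), mul_pow]
  simp only [EuclideanSpace.real_norm_sq_eq, tensor, Fintype.sum_prod_type, mul_pow,
    Finset.sum_mul_sum]

theorem norm_applyMat_le (q : Mat9) (n : Eu 3) : ‖applyMat q n‖ ≤ ‖q‖ * ‖n‖ := by
  rcases (norm_nonneg (applyMat q n)).eq_or_lt with h0 | hpos
  · rw [← h0]
    positivity
  refine le_of_mul_le_mul_left ?_ hpos
  calc ‖applyMat q n‖ * ‖applyMat q n‖ = inner ℝ (tensor (applyMat q n) n) q := by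
        rw [← inner_applyMat, real_inner_self_eq_norm_mul_norm]
    _ ≤ ‖applyMat q n‖ * ‖n‖ * ‖q‖ := norm_tensor _ n ▸ real_inner_le_norm _ q
    _ = ‖applyMat q n‖ * (‖q‖ * ‖n‖) := by ring

theorem continuous_applyMat : Continuous fun qn : Mat9 × Eu 3 => applyMat qn.1 qn.2 :=
  (PiLp.continuous_toLp 2 _).comp (continuous_pi fun a => by
    change Continuous fun qn : Mat9 × Eu 3 => ∑ b, qn.1 (a, b) * qn.2 b
    fun_prop)

theorem aestronglyMeasurable_applyMat {α : Type*} [MeasurableSpace α] {μ : Measure α}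
    {g : α → Mat9} {n : α → Eu 3} (hg : AEStronglyMeasurable g μ) (hn : AEStronglyMeasurable n μ) :
    AEStronglyMeasurable (fun x => applyMat (g x) (n x)) μ :=
  continuous_applyMat.comp_aestronglyMeasurable (hg.prodMk hn)

theorem continuous_tensor (e : Eu 3) : Continuous (tensor e) :=
  (PiLp.continuous_toLp 2 _).comp (continuous_pi fun ab => by fun_prop)

theorem projP_apply (s : ℝ) (n : Eu 3) (a b : Fin 3) :
    projP s n a b = s * (n a * n b - 1 / 3 * (1 : Matrix (Fin 3) (Fin 3) ℝ) a b) :=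
  rfl

theorem continuous_ofMatrix_projP (s : ℝ) : Continuous fun n => ofMatrix (projP s n) :=
  (PiLp.continuous_toLp 2 _).comp (continuous_pi fun ab => by
    simp only [projP_apply]
    fun_prop)

theorem sum_mul_self_eq_one {n : Eu 3} (hn : ‖n‖ = 1) : ∑ a, n a * n a = 1 := by
  simpa only [hn, one_pow, sq, one_mul] using (EuclideanSpace.real_norm_sq_eq n).symm

theorem trace_projP (s : ℝ) {n : Eu 3} (hn : ‖n‖ = 1) : ∑ a, projP s n a a = 0 := by
  simp only [projP_apply, Matrix.one_apply_eq, ← Finset.mul_sum, Finset.sum_sub_distrib,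
    sum_mul_self_eq_one hn]
  norm_num

/-- Contracting `f ⊗ n + n ⊗ f = g` with the unit vector `n` gives `f + ⟨n, f⟩ n = g n`, and the
trace condition says `⟨n, f⟩ = 0`. -/
theorem eq_applyMat_of_mul_add_mul_eq {n f : Eu 3} {g : Mat9} (hn : ‖n‖ = 1)
    (htr : ∑ a, g (a, a) = 0) (hg : ∀ a b, n b * f a + f b * n a = g (a, b)) :
    f = applyMat g n := by
  have horth : ∑ b, f b * n b = 0 := by
    simp only [← hg, Fin.sum_univ_three] at htr ⊢
    linarith
  ext a
  calc f a = f a * ∑ b, n b * n b + n a * ∑ b, f b * n b := by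
        rw [sum_mul_self_eq_one hn, horth, mul_one, mul_zero, add_zero]
    _ = ∑ b, (n b * f a + f b * n a) * n b := by
        simp only [Finset.mul_sum, ← Finset.sum_add_distrib]
        exact Finset.sum_congr rfl fun b _ => by ring
    _ = applyMat g n a := by simp only [hg, applyMat_apply]

end MatrixAlgebra

section Director

variable {d : ℕ} {Ω : Set (Eu d)} {s : ℝ}

/-- `n` is a unit vector field on `Ω` orienting the line field `q`, that is, `q = P(n)`. -/
def IsDirector (Ω : Set (Eu d)) (s : ℝ) (n : Eu d → Eu 3) (q : Eu d → Mat9) : Prop :=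
  ∀ᵐ x ∂volume.restrict Ω, ‖n x‖ = 1 ∧ projP s (n x) = asMatrix (q x)

theorem locallyIntegrableOn_clm_comp {E F : Type*} [NormedAddCommGroup E] [NormedSpace ℝ E]
    [NormedAddCommGroup F] [NormedSpace ℝ F] {u : Eu d → E} (hu : LocallyIntegrableOn u Ω)
    (L : E →L[ℝ] F) : LocallyIntegrableOn (fun x => L (u x)) Ω := by
  intro x hx
  obtain ⟨t, ht, hut⟩ := hu x hx
  exact ⟨t, ht, L.integrable_comp hut⟩

theorem locallyIntegrableOn_of_ae_norm_le_mul {E F : Type*} [NormedAddCommGroup E]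
    [NormedAddCommGroup F] {f : Eu d → E} {g : Eu d → F} {M : ℝ} (hg : LocallyIntegrableOn g Ω)
    (hf : AEStronglyMeasurable f (volume.restrict Ω))
    (hle : ∀ᵐ x ∂volume.restrict Ω, ‖f x‖ ≤ M * ‖g x‖) : LocallyIntegrableOn f Ω := by
  intro x hx
  obtain ⟨t, ht, hgt⟩ := hg x hx
  have hmono : volume.restrict (t ∩ Ω) ≤ volume.restrict Ω :=
    Measure.restrict_mono_set _ inter_subset_right
  exact ⟨t ∩ Ω, inter_mem ht self_mem_nhdsWithin,
    ((hgt.mono_set inter_subset_left).norm.const_mul M).mono' (hf.mono_measure hmono)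
      (ae_mono hmono hle)⟩

namespace IsDirector

variable {i : Fin d} {n f : Eu d → Eu 3} {q g : Eu d → Mat9}

theorem ae_norm_apply_le_one (h : IsDirector Ω s n q) (a : Fin 3) :
    ∀ᵐ x ∂volume.restrict Ω, ‖n x a‖ ≤ 1 :=
  h.mono fun x hx => hx.1 ▸ PiLp.norm_apply_le (n x) a

/-- The Leibniz rule applied to `nₐ n_b = s⁻¹ q_{ab} + δ_{ab} / 3`. -/
theorem ae_mul_add_mul_eq (h : IsDirector Ω s n q) (hΩ : IsOpen Ω) (hs : s ≠ 0)
    (hn : LocallyIntegrableOn n Ω) (hf : LocallyIntegrableOn f Ω) (hq : LocallyIntegrableOn q Ω)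
    (hg : LocallyIntegrableOn g Ω) (hnf : IsWeakPartial Ω i n f) (hqg : IsWeakPartial Ω i q g)
    (a b : Fin 3) :
    ∀ᵐ x ∂volume.restrict Ω, n x b * f x a + f x b * n x a = s⁻¹ * g x (a, b) := by
  let π (c : Fin 3) : Eu 3 →L[ℝ] ℝ := EuclideanSpace.proj c
  have hnc : ∀ c, LocallyIntegrableOn (fun x => n x c) Ω := fun c =>
    locallyIntegrableOn_clm_comp hn (π c)
  have hfc : ∀ c, LocallyIntegrableOn (fun x => f x c) Ω := fun c =>
    locallyIntegrableOn_clm_comp hf (π c)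
  have hpartial : ∀ c, IsWeakPartial Ω i (fun x => n x c) fun x => f x c := fun c => by
    simpa only [π, PiLp.proj_apply, add_zero] using hnf.clm_add_const hn hf (π c) 0
  have hbd : ∀ c, ∀ᵐ x, x ∈ Ω → ‖n x c‖ ≤ 1 := fun c =>
    ae_imp_of_ae_restrict (h.ae_norm_apply_le_one c)
  have hprod := (hpartial b).smul hΩ (hpartial a) (hnc b) (hfc b) (hnc a) (hfc a) (hbd b) (hbd a)
  have hentry := hqg.clm_add_const hq hg (s⁻¹ • (EuclideanSpace.proj (a, b) : Mat9 →L[ℝ] ℝ))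
    (1 / 3 * (1 : Matrix (Fin 3) (Fin 3) ℝ) a b)
  refine IsWeakPartial.ae_unique hΩ hprod (hentry.congr_ae ?_ .rfl) ?_ ?_
  · filter_upwards [h] with x hx
    have hqab : q x (a, b) = projP s (n x) a b := congrFun₂ hx.2.symm a b
    simp only [smul_apply, PiLp.proj_apply, smul_eq_mul, hqab, projP_apply]
    rw [inv_mul_cancel_left₀ hs]
    ring
  · have hterm : ∀ c e, LocallyIntegrableOn (fun x => n x c * f x e) Ω := fun c e =>
      locallyIntegrableOn_of_ae_norm_le_mul (hfc e)
        ((hnc c).aestronglyMeasurable.mul (hfc e).aestronglyMeasurable)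
        ((h.ae_norm_apply_le_one c).mono fun x hx => norm_mul_le_of_le hx le_rfl)
    refine (hterm b a).add ?_
    simpa only [smul_eq_mul, mul_comm] using hterm a b
  · exact locallyIntegrableOn_clm_comp hg (s⁻¹ • (EuclideanSpace.proj (a, b) : Mat9 →L[ℝ] ℝ))

theorem ae_trace_eq_zero (h : IsDirector Ω s n q) (hΩ : IsOpen Ω) (hq : LocallyIntegrableOn q Ω)
    (hg : LocallyIntegrableOn g Ω) (hqg : IsWeakPartial Ω i q g) :
    ∀ᵐ x ∂volume.restrict Ω, ∑ a, g x (a, a) = 0 := by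
  let tr : Mat9 →L[ℝ] ℝ := ∑ a, EuclideanSpace.proj (a, a)
  have htr : ∀ r : Mat9, tr r = ∑ a, r (a, a) := fun r => by
    simp only [tr, sum_apply, PiLp.proj_apply]
  have hzero := hqg.clm_add_const hq hg (0 : Mat9 →L[ℝ] ℝ) 0
  have htrace : IsWeakPartial Ω i (fun x => (0 : Mat9 →L[ℝ] ℝ) (q x) + 0) fun x => tr (g x) := by
    refine (hqg.clm_add_const hq hg tr 0).congr_ae ?_ .rfl
    filter_upwards [h] with x hx
    have hP : ∑ a, q x (a, a) = ∑ a, projP s (n x) a a := by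
      rw [hx.2]
      rfl
    rw [htr, hP, trace_projP s hx.1, zero_apply]
  filter_upwards [htrace.ae_unique hΩ hzero (locallyIntegrableOn_clm_comp hg tr)
    (locallyIntegrableOn_clm_comp hg 0)] with x hx
  rw [← htr, hx, zero_apply]

theorem ae_eq_smul_applyMat (h : IsDirector Ω s n q) (hΩ : IsOpen Ω) (hs : s ≠ 0)
    (hn : LocallyIntegrableOn n Ω) (hf : LocallyIntegrableOn f Ω) (hq : LocallyIntegrableOn q Ω)
    (hg : LocallyIntegrableOn g Ω) (hnf : IsWeakPartial Ω i n f) (hqg : IsWeakPartial Ω i q g) :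
    ∀ᵐ x ∂volume.restrict Ω, f x = applyMat (s⁻¹ • g x) (n x) := by
  filter_upwards [h, h.ae_trace_eq_zero hΩ hq hg hqg, ae_all_iff.2 fun a => ae_all_iff.2 fun b =>
    h.ae_mul_add_mul_eq hΩ hs hn hf hq hg hnf hqg a b] with x hx htr hmul
  refine eq_applyMat_of_mul_add_mul_eq hx.1 ?_ hmul
  simp only [PiLp.smul_apply, ← Finset.smul_sum, htr, smul_zero]

end IsDirector

end Director

section WeakConvergence

theorem exists_clm_eq_integral_inner {α F : Type*} {m : MeasurableSpace α} {μ : Measure α}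
    [NormedAddCommGroup F] [InnerProductSpace ℝ F] {p : ℝ≥0∞} [hp : Fact (1 ≤ p)] {H : α → F}
    (hH : MemLp H (ENNReal.conjExponent p) μ) :
    ∃ L : Lp F p μ →L[ℝ] ℝ, ∀ u, L u = ∫ x, inner ℝ (H x) (u x) ∂μ := by
  have hq : ENNReal.HolderConjugate (ENNReal.conjExponent p) p :=
    (ENNReal.HolderConjugate.conjExponent hp.out).symm
  have : Fact (1 ≤ ENNReal.conjExponent p) := ⟨hq.one_le⟩
  refine ⟨(innerSL ℝ).lpPairing μ (ENNReal.conjExponent p) p (hH.toLp _), fun u => ?_⟩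
  rw [ContinuousLinearMap.lpPairing_eq_integral]
  refine integral_congr_ae ?_
  filter_upwards [hH.coeFn_toLp] with x hx
  rw [hx, innerSL_apply_apply]

variable {d : ℕ} {Ω : Set (Eu d)} {p : ℝ≥0∞} [hp : Fact (1 ≤ p)] {F : Type*}
  [NormedAddCommGroup F]

theorem locallyIntegrableOn_toFun [NormedSpace ℝ F] (U : W1p Ω p F) :
    LocallyIntegrableOn (toFun U) Ω :=
  locallyIntegrableOn_of_locallyIntegrable_restrict ((Lp.memLp U.1.1).locallyIntegrable hp.out)

theorem locallyIntegrableOn_partialDeriv [NormedSpace ℝ F] (U : W1p Ω p F) (i : Fin d) :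
    LocallyIntegrableOn (partialDeriv U i) Ω :=
  locallyIntegrableOn_of_locallyIntegrable_restrict ((Lp.memLp (U.1.2 i)).locallyIntegrable hp.out)

variable [InnerProductSpace ℝ F] {U : ℕ → W1p Ω p F} {V : W1p Ω p F}

theorem WeaklyConverges.tendsto_integral_inner (hU : WeaklyConverges U V) {H : Eu d → F}
    (hH : MemLp H (ENNReal.conjExponent p) (volume.restrict Ω)) :
    Tendsto (fun k => ∫ x in Ω, inner ℝ (H x) (toFun (U k) x)) atTop
      (𝓝 (∫ x in Ω, inner ℝ (H x) (toFun V x))) ∧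
    ∀ i : Fin d, Tendsto (fun k => ∫ x in Ω, inner ℝ (H x) (partialDeriv (U k) i x)) atTop
      (𝓝 (∫ x in Ω, inner ℝ (H x) (partialDeriv V i x))) := by
  obtain ⟨L, hL⟩ := exists_clm_eq_integral_inner hH
  refine ⟨?_, fun i => ?_⟩
  · simpa only [ContinuousLinearMap.comp_apply, Submodule.subtypeL_apply,
      ContinuousLinearMap.coe_fst', hL, toFun] using
      hU (L.comp ((ContinuousLinearMap.fst ℝ _ _).comp (W1p Ω p F).subtypeL))
  · simpa only [ContinuousLinearMap.comp_apply, Submodule.subtypeL_apply,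
      ContinuousLinearMap.coe_snd', ContinuousLinearMap.proj_apply, hL, partialDeriv] using
      hU (L.comp ((ContinuousLinearMap.proj i).comp
        ((ContinuousLinearMap.snd ℝ _ _).comp (W1p Ω p F).subtypeL)))

theorem tendstoWeakL1_restrict (hweak : p ≠ ⊤ → WeaklyConverges U V)
    (hweakStar : p = ⊤ → WeakStarConverges U V) {K : Set (Eu d)} (hKΩ : K ⊆ Ω)
    (hK : IsCompact K) :
    TendstoWeakL1 (volume.restrict K) (fun k => toFun (U k)) (toFun V) ∧
    ∀ i, TendstoWeakL1 (volume.restrict K) (fun k => partialDeriv (U k) i) (partialDeriv V i) := by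
  have : IsFiniteMeasure (volume.restrict K) := isFiniteMeasure_restrict.2 hK.measure_lt_top.ne
  have hind : ∀ {h : Eu d → F}, MemLp h ∞ (volume.restrict K) → ∀ q,
      MemLp (K.indicator h) q (volume.restrict Ω) := fun hh q => by
    rw [memLp_indicator_iff_restrict hK.measurableSet, Measure.restrict_restrict hK.measurableSet,
      inter_eq_self_of_subset_left hKΩ]
    exact hh.mono_exponent le_top
  have hset : ∀ h u : Eu d → F,
      ∫ x in Ω, inner ℝ (K.indicator h x) (u x) = ∫ x in K, inner ℝ (h x) (u x) := fun h u => by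
    rw [← inter_eq_self_of_subset_right hKΩ, ← setIntegral_indicator hK.measurableSet]
    refine integral_congr_ae (ae_of_all _ fun x => ?_)
    by_cases hx : x ∈ K
    · simp only [inter_eq_self_of_subset_right hKΩ, indicator_of_mem hx]
    · simp only [inter_eq_self_of_subset_right hKΩ, indicator_of_notMem hx, inner_zero_left]
  have hlim : ∀ {h : Eu d → F}, MemLp h ∞ (volume.restrict K) →
      Tendsto (fun k => ∫ x in K, inner ℝ (h x) (toFun (U k) x)) atTop
        (𝓝 (∫ x in K, inner ℝ (h x) (toFun V x))) ∧
      ∀ i : Fin d, Tendsto (fun k => ∫ x in K, inner ℝ (h x) (partialDeriv (U k) i x)) atTop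
        (𝓝 (∫ x in K, inner ℝ (h x) (partialDeriv V i x))) := fun {h} hh => by
    simp only [← hset h]
    by_cases hp' : p = ⊤
    · exact hweakStar hp' _ (memLp_one_iff_integrable.1 (hind hh 1))
    · exact (hweak hp').tendsto_integral_inner (hind hh _)
  exact ⟨fun h hh => (hlim hh).1, fun i h hh => (hlim hh).2 i⟩

end WeakConvergence

section Limit

variable {d : ℕ} {Ω : Set (Eu d)}

theorem locallyIntegrableOn_applyMat {g : Eu d → Mat9} {n : Eu d → Eu 3} {M : ℝ}
    (hg : LocallyIntegrableOn g Ω) (hn : AEStronglyMeasurable n (volume.restrict Ω))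
    (hM : ∀ᵐ x ∂volume.restrict Ω, ‖n x‖ ≤ M) :
    LocallyIntegrableOn (fun x => applyMat (g x) (n x)) Ω := by
  refine locallyIntegrableOn_of_ae_norm_le_mul (M := M) hg
    (aestronglyMeasurable_applyMat hg.aestronglyMeasurable hn)
    (hM.mono fun x hx => (norm_applyMat_le (g x) (n x)).trans ?_)
  rw [mul_comm]
  gcongr

theorem IsTestFunction.inner_integral_smul_applyMat {φ : Eu d → ℝ} (hφ : IsTestFunction Ω φ)
    {g : Eu d → Mat9} {n : Eu d → Eu 3}
    (hgn : LocallyIntegrableOn (fun x => applyMat (g x) (n x)) Ω) (e : Eu 3) :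
    inner ℝ e (∫ x, φ x • applyMat (g x) (n x)) =
      ∫ x in tsupport φ, inner ℝ (φ x • tensor e (n x)) (g x) := by
  rw [← integral_inner (hφ.integrable_smul hgn)]
  simp only [real_inner_smul_right, real_inner_smul_left, inner_applyMat]
  refine (setIntegral_eq_integral_of_forall_compl_eq_zero fun x hx => ?_).symm
  rw [image_eq_zero_of_notMem_tsupport hx, zero_mul]

theorem IsTestFunction.tendsto_integral_smul {φ : Eu d → ℝ} (hφ : IsTestFunction Ω φ)
    {F : Type*} [NormedAddCommGroup F] [NormedSpace ℝ F] {u : ℕ → Eu d → F} {u' : Eu d → F} {M : ℝ}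
    (hu : ∀ k, AEStronglyMeasurable (u k) (volume.restrict Ω))
    (hM : ∀ k, ∀ᵐ x ∂volume.restrict Ω, ‖u k x‖ ≤ M)
    (hlim : ∀ᵐ x ∂volume.restrict Ω, Tendsto (fun k => u k x) atTop (𝓝 (u' x))) :
    Tendsto (fun k => ∫ x, φ x • u k x) atTop (𝓝 (∫ x, φ x • u' x)) := by
  simp only [← hφ.setIntegral_smul]
  refine tendsto_integral_of_dominated_convergence (fun x => ‖φ x‖ * M)
    (fun k => hφ.continuous.aestronglyMeasurable.smul (hu k)) ?_ (fun k => ?_) ?_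
  · exact ((hφ.continuous.integrable_of_hasCompactSupport hφ.hasCompactSupport).norm.mul_const
      M).restrict
  · filter_upwards [hM k] with x hx
    rw [norm_smul]
    gcongr
  · filter_upwards [hlim] with x hx
    exact hx.const_smul (φ x)

section ApplyMatLimit

variable {n : ℕ → Eu d → Eu 3} {n' : Eu d → Eu 3} {g : ℕ → Eu d → Mat9} {g' : Eu d → Mat9} {M : ℝ}

/-- A product of a weakly convergent factor with a bounded, almost everywhere convergent one passes
to the limit, once the latter is moved into the test function by `inner_applyMat`. -/
theorem IsTestFunction.tendsto_inner_integral_smul_applyMat {φ : Eu d → ℝ}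
    (hφ : IsTestFunction Ω φ)
    (hn : ∀ k, AEStronglyMeasurable (n k) (volume.restrict Ω))
    (hM : ∀ k, ∀ᵐ x ∂volume.restrict Ω, ‖n k x‖ ≤ M)
    (hlim : ∀ᵐ x ∂volume.restrict Ω, Tendsto (fun k => n k x) atTop (𝓝 (n' x)))
    (hg : ∀ k, LocallyIntegrableOn (g k) Ω) (hg' : LocallyIntegrableOn g' Ω)
    (hw : TendstoWeakL1 (volume.restrict (tsupport φ)) g g') (e : Eu 3) :
    Tendsto (fun k => inner ℝ e (∫ x, φ x • applyMat (g k x) (n k x))) atTop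
      (𝓝 (inner ℝ e (∫ x, φ x • applyMat (g' x) (n' x)))) := by
  have hK : IsCompact (tsupport φ) := hφ.hasCompactSupport
  have hKΩ := hφ.tsupport_subset
  have : IsFiniteMeasure (volume.restrict (tsupport φ)) :=
    isFiniteMeasure_restrict.2 hK.measure_lt_top.ne
  obtain ⟨C, hC⟩ := hφ.exists_norm_le
  have hM' : ∀ᵐ x ∂volume.restrict Ω, ‖n' x‖ ≤ M := by
    filter_upwards [hlim, ae_all_iff.2 hM] with x hx hMx
    exact le_of_tendsto' hx.norm hMx
  rw [hφ.inner_integral_smul_applyMat (locallyIntegrableOn_applyMat hg'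
    (aestronglyMeasurable_of_tendsto_ae atTop hn hlim) hM')]
  simp only [fun k => hφ.inner_integral_smul_applyMat
    (locallyIntegrableOn_applyMat (hg k) (hn k) (hM k)) e]
  refine hw.tendsto_integral_inner (C := C * (‖e‖ * M))
    (fun k => (hg k).integrableOn_compact_subset hKΩ hK)
    (hg'.integrableOn_compact_subset hKΩ hK) (fun k => ?_) (fun k => ?_) ?_
  · exact hφ.continuous.aestronglyMeasurable.smul
      ((continuous_tensor e).comp_aestronglyMeasurable ((hn k).mono_set hKΩ))
  · filter_upwards [ae_restrict_of_ae_restrict_of_subset hKΩ (hM k)] with x hx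
    have hC0 := (norm_nonneg _).trans (hC x)
    rw [norm_smul, norm_tensor]
    gcongr
    exact hC x
  · filter_upwards [ae_restrict_of_ae_restrict_of_subset hKΩ hlim] with x hx
    exact (((continuous_tensor e).tendsto _).comp hx).const_smul (φ x)

theorem isWeakPartial_applyMat_of_tendsto {i : Fin d}
    (hn : ∀ k, AEStronglyMeasurable (n k) (volume.restrict Ω))
    (hM : ∀ k, ∀ᵐ x ∂volume.restrict Ω, ‖n k x‖ ≤ M)
    (hlim : ∀ᵐ x ∂volume.restrict Ω, Tendsto (fun k => n k x) atTop (𝓝 (n' x)))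
    (hg : ∀ k, LocallyIntegrableOn (g k) Ω) (hg' : LocallyIntegrableOn g' Ω)
    (hw : ∀ K ⊆ Ω, IsCompact K → TendstoWeakL1 (volume.restrict K) g g')
    (hD : ∀ k, IsWeakPartial Ω i (n k) fun x => applyMat (g k x) (n k x)) :
    IsWeakPartial Ω i n' fun x => applyMat (g' x) (n' x) := by
  refine isWeakPartial_iff.2 fun φ hφ => ext_inner_left ℝ fun e => ?_
  have hleft : Tendsto (fun k => inner ℝ e (∫ x, pderiv i φ x • n k x)) atTop
      (𝓝 (inner ℝ e (∫ x, pderiv i φ x • n' x))) :=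
    tendsto_const_nhds.inner ((hφ.pderiv i).tendsto_integral_smul hn hM hlim)
  have hright := hφ.tendsto_inner_integral_smul_applyMat hn hM hlim hg hg'
    (hw _ hφ.tsupport_subset hφ.hasCompactSupport) e
  simp only [fun k => isWeakPartial_iff.1 (hD k) φ hφ, inner_neg_right] at hleft ⊢
  exact tendsto_nhds_unique hleft hright.neg

end ApplyMatLimit

theorem IsDirector.of_tendsto (hΩ : IsOpen Ω) {s : ℝ} {n : ℕ → Eu d → Eu 3} {n' : Eu d → Eu 3}
    {q : ℕ → Eu d → Mat9} {q' : Eu d → Mat9} (hnq : ∀ k, IsDirector Ω s (n k) (q k))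
    (hq : ∀ k, LocallyIntegrableOn (q k) Ω) (hq' : LocallyIntegrableOn q' Ω)
    (hlim : ∀ᵐ x ∂volume.restrict Ω, Tendsto (fun k => n k x) atTop (𝓝 (n' x)))
    (hw : ∀ K ⊆ Ω, IsCompact K → TendstoWeakL1 (volume.restrict K) q q') :
    IsDirector Ω s n' q' := by
  have hnorm : ∀ᵐ x ∂volume.restrict Ω, ‖n' x‖ = 1 := by
    filter_upwards [hlim, ae_all_iff.2 hnq] with x hx hnqx
    exact tendsto_nhds_unique hx.norm (by simp only [(hnqx _).1, tendsto_const_nhds])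
  have hqn : ∀ k, ∀ᵐ x ∂volume.restrict Ω, q k x = ofMatrix (projP s (n k x)) := fun k =>
    (hnq k).mono fun x hx => asMatrix_injective hx.2.symm
  obtain ⟨C, hC⟩ := (isCompact_sphere (0 : Eu 3) 1).exists_bound_of_continuousOn
    (continuous_ofMatrix_projP s).continuousOn
  have hbound : ∀ k, ∀ᵐ x ∂volume.restrict Ω, ‖q k x‖ ≤ C := fun k => by
    filter_upwards [hqn k, hnq k] with x hx hnqx
    exact hx ▸ hC _ (mem_sphere_zero_iff_norm.2 hnqx.1)
  have hstrong : ∀ᵐ x ∂volume.restrict Ω,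
      Tendsto (fun k => q k x) atTop (𝓝 (ofMatrix (projP s (n' x)))) := by
    filter_upwards [hlim, ae_all_iff.2 hqn] with x hx hqnx
    simp only [hqnx]
    exact ((continuous_ofMatrix_projP s).tendsto _).comp hx
  have heq : ∀ᵐ x ∂volume.restrict Ω, q' x = ofMatrix (projP s (n' x)) := by
    refine ae_restrict_of_forall_isCompact hΩ fun K hKΩ hK => ?_
    have : IsFiniteMeasure (volume.restrict K) := isFiniteMeasure_restrict.2 hK.measure_lt_top.ne
    have hstrongK := ae_restrict_of_ae_restrict_of_subset hKΩ hstrong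
    have hboundK := fun k => ae_restrict_of_ae_restrict_of_subset hKΩ (hbound k)
    have hqK := fun k => ((hq k).integrableOn_compact_subset hKΩ hK).aestronglyMeasurable
    have hlimK := aestronglyMeasurable_of_tendsto_ae atTop hqK hstrongK
    refine TendstoWeakL1.ae_eq (hq'.integrableOn_compact_subset hKΩ hK)
      (Integrable.of_bound hlimK C ?_) (hw K hKΩ hK)
      (TendstoWeakL1.of_ae_tendsto hqK hboundK hstrongK)
    filter_upwards [hstrongK, ae_all_iff.2 hboundK] with x hx hCx
    exact le_of_tendsto' hx.norm hCx
  filter_upwards [hnorm, heq] with x hx hqx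
  exact ⟨hx, hqx ▸ rfl⟩

end Limit

section Orientable

variable {d : ℕ} {Ω : Set (Eu d)} {s : ℝ} {p : ℝ≥0∞} [hp : Fact (1 ≤ p)]

theorem isOrientable_iff {Q : W1p Ω p Mat9} :
    IsOrientable s Q ↔ ∃ n : W1p Ω p (Eu 3), IsDirector Ω s (toFun n) (toFun Q) := by
  constructor
  · rintro ⟨-, n, hn, hnQ⟩
    exact ⟨n, (hn.and hnQ).mono fun x hx => ⟨mem_sphere_zero_iff_norm.1 hx.1, hx.2⟩⟩
  · rintro ⟨n, hn⟩
    exact ⟨hn.mono fun x hx => ⟨_, mem_sphere_zero_iff_norm.2 hx.1, hx.2.symm⟩, n,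
      hn.mono fun x hx => mem_sphere_zero_iff_norm.2 hx.1, hn.mono fun x hx => hx.2⟩

theorem IsDirector.partialDeriv_ae_eq (hΩ : IsOpen Ω) (hs : s ≠ 0) {n : W1p Ω p (Eu 3)}
    {Q : W1p Ω p Mat9} (h : IsDirector Ω s (toFun n) (toFun Q)) (i : Fin d) :
    partialDeriv n i =ᵐ[volume.restrict Ω]
      fun x => applyMat (s⁻¹ • partialDeriv Q i x) (toFun n x) :=
  h.ae_eq_smul_applyMat hΩ hs (locallyIntegrableOn_toFun n) (locallyIntegrableOn_partialDeriv n i)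
    (locallyIntegrableOn_toFun Q) (locallyIntegrableOn_partialDeriv Q i) (n.2 i) (Q.2 i)

theorem IsDirector.exists_subseq_ae_tendsto (hΩ : IsOpen Ω) (hs : s ≠ 0)
    {n : ℕ → W1p Ω p (Eu 3)} {Qk : ℕ → W1p Ω p Mat9} {Q : W1p Ω p Mat9}
    (h : ∀ k, IsDirector Ω s (toFun (n k)) (toFun (Qk k)))
    (hw : ∀ K ⊆ Ω, IsCompact K → ∀ i,
      TendstoWeakL1 (volume.restrict K) (fun k => partialDeriv (Qk k) i) (partialDeriv Q i)) :
    ∃ ns : ℕ → ℕ, StrictMono ns ∧ ∃ n' : Eu d → Eu 3,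
      ∀ᵐ x ∂volume.restrict Ω, Tendsto (fun k => toFun (n (ns k)) x) atTop (𝓝 (n' x)) := by
  have hderiv : ∀ k i, ∀ᵐ x ∂volume.restrict Ω,
      ‖partialDeriv (n k) i x‖ ≤ |s⁻¹| * ‖partialDeriv (Qk k) i x‖ := fun k i => by
    filter_upwards [(h k).partialDeriv_ae_eq hΩ hs i, h k] with x hx hnx
    simpa only [hx, hnx.1, mul_one, norm_smul, Real.norm_eq_abs] using
      norm_applyMat_le (s⁻¹ • partialDeriv (Qk k) i x) (toFun (n k) x)
  obtain ⟨ns, hns, n', -, hlim⟩ := exists_subseq_ae_tendsto_of_isWeakPartial hΩ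
    (fun k => Lp.aestronglyMeasurable (n k).1.1) (fun k => (h k).mono fun x hx => hx.1.le)
    (fun k i => locallyIntegrableOn_partialDeriv (n k) i) (fun k i => (n k).2 i)
    fun K hKΩ hK i => by
      obtain ⟨C, hC⟩ := (hw K hKΩ hK i).exists_integral_norm_le fun k =>
        (locallyIntegrableOn_partialDeriv (Qk k) i).integrableOn_compact_subset hKΩ hK
      refine ⟨|s⁻¹| * C, fun k => ?_⟩
      calc ∫ x in K, ‖partialDeriv (n k) i x‖
          ≤ ∫ x in K, |s⁻¹| * ‖partialDeriv (Qk k) i x‖ :=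
            integral_mono_ae
              ((locallyIntegrableOn_partialDeriv (n k) i).integrableOn_compact_subset hKΩ hK).norm
              (((locallyIntegrableOn_partialDeriv (Qk k) i).integrableOn_compact_subset
                hKΩ hK).norm.const_mul _)
              (ae_restrict_of_ae_restrict_of_subset hKΩ (hderiv k i))
        _ ≤ |s⁻¹| * C := by
            rw [integral_const_mul]
            gcongr
            exact hC k
  exact ⟨ns, hns, n', hlim⟩

theorem IsDirector.isOrientable {Q : W1p Ω p Mat9} {n : Eu d → Eu 3}
    (h : IsDirector Ω s n (toFun Q)) (hn : MemLp n p (volume.restrict Ω))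
    (hD : ∀ i, IsWeakPartial Ω i n fun x => applyMat (s⁻¹ • partialDeriv Q i x) (n x)) :
    IsOrientable s Q := by
  have hDL : ∀ i, MemLp (fun x => applyMat (s⁻¹ • partialDeriv Q i x) (n x)) p
      (volume.restrict Ω) := fun i => by
    have hQ : MemLp (partialDeriv Q i) p (volume.restrict Ω) := Lp.memLp (Q.1.2 i)
    refine hQ.of_le_mul (c := |s⁻¹|) (aestronglyMeasurable_applyMat (hQ.1.const_smul s⁻¹) hn.1) ?_
    filter_upwards [h] with x hx
    simpa only [hx.1, mul_one, norm_smul, Real.norm_eq_abs] using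
      norm_applyMat_le (s⁻¹ • partialDeriv Q i x) (n x)
  let N : W1p Ω p (Eu 3) := ⟨(hn.toLp n, fun i => (hDL i).toLp _), fun i =>
    (hD i).congr_ae hn.coeFn_toLp.symm (hDL i).coeFn_toLp.symm⟩
  refine isOrientable_iff.2 ⟨N, ?_⟩
  filter_upwards [h, hn.coeFn_toLp] with x hx hNx
  rwa [show toFun N x = n x from hNx]

end Orientable

end LineField

end

open LineField in
theorem mainTheorem7_general {d : ℕ} {Ω : Set (Eu d)} (hΩ : IsOpen Ω) {s : ℝ}
    (hs : s ≠ 0) {p : ℝ≥0∞} [Fact (1 ≤ p)] {Qk : ℕ → W1p Ω p Mat9}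
    {Q : W1p Ω p Mat9} (horient : ∀ k, IsOrientable s (Qk k))
    (hweak : p ≠ ⊤ → WeaklyConverges Qk Q)
    (hweakStar : p = ⊤ → WeakStarConverges Qk Q) : IsOrientable s Q := by
  choose n hn using fun k => isOrientable_iff.1 (horient k)
  have hw := fun (K : Set (Eu d)) (hKΩ : K ⊆ Ω) (hK : IsCompact K) =>
    tendstoWeakL1_restrict hweak hweakStar hKΩ hK
  obtain ⟨ns, hns, n', hlim⟩ := IsDirector.exists_subseq_ae_tendsto hΩ hs hn
    fun K hKΩ hK => (hw K hKΩ hK).2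
  have hnmeas := fun k => Lp.aestronglyMeasurable (n (ns k)).1.1
  have hdir : IsDirector Ω s n' (toFun Q) :=
    .of_tendsto hΩ (fun k => hn (ns k)) (fun k => locallyIntegrableOn_toFun (Qk (ns k)))
      (locallyIntegrableOn_toFun Q) hlim fun K hKΩ hK => (hw K hKΩ hK).1.comp_strictMono hns
  have hpartial : ∀ i, IsWeakPartial Ω i n' fun x => applyMat (s⁻¹ • partialDeriv Q i x) (n' x) :=
    fun i => isWeakPartial_applyMat_of_tendsto hnmeas
      (fun k => (hn (ns k)).mono fun x hx => hx.1.le) hlim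
      (fun k => (locallyIntegrableOn_partialDeriv (Qk (ns k)) i).smul s⁻¹)
      ((locallyIntegrableOn_partialDeriv Q i).smul s⁻¹)
      (fun K hKΩ hK => (((hw K hKΩ hK).2 i).comp_strictMono hns).const_smul s⁻¹)
      fun k => ((n (ns k)).2 i).congr_ae .rfl ((hn (ns k)).partialDeriv_ae_eq hΩ hs i)
  refine hdir.isOrientable ((Lp.memLp (n 0).1.1).congr_norm
    (aestronglyMeasurable_of_tendsto_ae atTop hnmeas hlim) ?_) hpartial
  filter_upwards [hn 0, hdir] with x hx hx'
  exact hx.1.trans hx'.1.symm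

theorem mainTheorem7 (d : ℕ) (Ω : Set (LineField.Eu d)) (hopen : IsOpen Ω)
    (hconn : IsConnected Ω) (hbdd : Bornology.IsBounded Ω) (hC0 : LineField.HasC0Boundary Ω)
    (s : ℝ) (hs : s ∈ Set.Icc (-1 / 2 : ℝ) 1) (hs0 : s ≠ 0)
    (p : ENNReal) [Fact (1 ≤ p)]
    (Qk : ℕ → LineField.W1p Ω p LineField.Mat9) (Q : LineField.W1p Ω p LineField.Mat9)
    (horient : ∀ k, LineField.IsOrientable s (Qk k))
    (hweak : p ≠ ⊤ → LineField.WeaklyConverges Qk Q)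
    (hweakStar : p = ⊤ → LineField.WeakStarConverges Qk Q) :
    LineField.IsOrientable s Q :=
  mainTheorem7_general hopen hs0 horient hweak hweakStar
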